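/- **Setting.** Let $\mathcal D_X$ be a known probability distribution on $\mathbb R$, and let $H=\{h_\tau:\tau\in T\}$ with $h_\tau(x)=1_{x\ge\tau}$ be a class of one-dimensional threshold functions, $\emptyset\ne T\subseteq\mathbb R$ (for instance $T=\mathbb R$). For a distribution $\mathcal D$ on $\mathbb R\times\{0,1\}$ put $\mathrm{err}(h)=\Pr_{(x,y)\sim\mathcal D}[h(x)\ne y]$. An active learner adaptively queries points $x$ and receives, for each query, an independent label $y\sim(Y\mid X=x)$. It solves $(\eta,\varepsilon,\delta)$ active agnostic learning with $m$ samples if, for every $\mathcal D$ with marginal $\mathcal D_X$ for which some $h\in H$ has $\mathrm{err}(h)\le\eta$, with probability at least $1-\delta$ it uses at most $m$ queries and outputs $\widehat h\in H$ with $\mathrm{err}(\widehat h)\le\eta+\varepsilon$. Write $\|h-g\|=\Pr_{x\sim\mathcal D_X}[h(x)\neq g(x)]$ and $\mathrm{lg}\,t=\max\{1,\log t\}$. **Algorithm 1** (noise level $\eta'>0$, accuracy $\varepsilon$, confidence $\delta$, constants $c_4,c_5,K_1,K_2$; $\alpha=1/5$, $R=c_4\eta'+c_5\varepsilon$). Let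 $H'\subseteq H$ be a maximal $2\eta'$-packing (maximal among the finite subsets of $H$ whose distinct members are at distance $>2\eta'$). Let $w(h)=1$ for $h\in H'$ and $S=C=\emptyset$. For a probability vector $\lambda$ on $H'$ and $S\subseteq H'$ the capped vector is $\overline\lambda_S(h)=\frac12\lambda(h)$ for $h\in S$ and $\overline\lambda_S(h)=\lambda(h)\frac{1-\frac12\lambda(S)}{1-\lambda(S)}$ for $h\in H'\setminus S$; balls are $B(\mu,r)=\{h\in H':\|h-\mu\|\le r\}$ with $\mu\in H'$. *Stage one.* Repeat $\lceil K_1\log(|H'|/\delta)\rceil$ times: (i) let $\lambda=w/\sum_{h\in H'}w(h)$; (ii) if some ball of radius $R$ has $\overline\lambda_S$-mass more than $80\%$, let $B(\mu',R)$ be a ball of radius $R$ of largest $\lambda$-mass, add $B(\mu',3R)$ to $S$ and $\mu'$ to $C$; (iii) with $\overline r(x)=\min\{\sum_h\overline\lambda_S(h)h(x),\,1-\sum_h\overline\lambda_S(h)h(x)\}$, let the probability distribution $q^*$ maximize $\mathbb E_{x\sim q}[\overline r(x)]-\frac{c_4}{20}\eta'\max_x\frac{q(x)}{\mathcal D_X(x)}$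 over $q$, where $\max_x\frac{q(x)}{\mathcal D_X(x)}$ is the least $M$ with $q\le M\mathcal D_X$; (iv) query $x\sim q^*$, getting $y$, and multiply $w(h)$ by $e^{-\alpha}$ for all $h\in H'$ with $h(x)\ne y$. *Stage two.* Let $\eta_2=3\eta'+3R$ and $t=\lceil K_2\log(|C|/\delta)\rceil$, with $C$ the set of centers found in stage one. As long as there are candidates $h,h'\in C$ with $\|h-h'\|\ge3\eta_2$, take such a pair, query $t$ independent points from $\mathcal D_X$ conditioned on $h(x)\ne h'(x)$, and remove from $C$ one of $h,h'$ that is wrong on at least half of them. Return any remaining candidate. Where several choices are possible (the packing, the heaviest ball, $q^*$, the pair, the removed candidate in a tie, the returned candidate) any fixed rule may be used, depending only on the current data of the algorithm: for the heaviest ball on $\lambda$, for $q^*$ on $\overline\lambda_S$, and for the pair, its order (in a tie its first member is removed) and the returned candidate on the current set of candidates. **Statement.** There are absolute constants $c_1>1$, $c_4\ge300$, $0<c_5\le\frac1{10}$ and $K_1,K_2,K>0$ such that for all $\mathcal D_X$ and $H$ as above and all $\eta\ge0$, $\varepsilon,\delta\in(0,1)$ with $\varepsilon>c_1\eta$ the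 following holds. Algorithm 1 with noise level $\eta'=\varepsilon/c_1$ is well defined (the required packing and maximizers exist), and, whatever rule is used for the open choices, it solves $(\eta,\varepsilon,\delta)$ active agnostic learning with at most $$K\,\mathrm{lg}\frac1{\varepsilon\delta}\cdot\mathrm{lg}\frac{\mathrm{lg}\frac1\varepsilon}{\delta}$$ samples, that is, with $O\!\left(\log\frac1{\varepsilon\delta}\,\log\frac{\log\frac1\varepsilon}{\delta}\right)$ samples. -/

import Mathlib

open MeasureTheory ProbabilityTheory
open scoped ENNReal

namespace ActiveLearning

noncomputable section

open scoped Classical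

/-! ### Active learners and what it means to solve an instance -/

/-- A randomized adaptive learner on the domain `X`, as an interaction tree.  Either it stops with
an output, or it draws a point `x` from the distribution `q`, asks for the label `y` of `x`, and
continues as `next x y`. -/
inductive Prog (X : Type) [MeasurableSpace X] (Out : Type) : Type
  | ret (o : Out) : Prog X Out
  | query (q : Measure X) (next : X → Bool → Prog X Out) : Prog X Out

/-- Sequential composition of learners. -/
def Prog.bind {X : Type} [MeasurableSpace X] {A B : Type} :
    Prog X A → (A → Prog X B) → Prog X B
  | .ret a, f => f a
  | .query q next, f => .query q fun x y => (next x y).bind f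

/-- The probability that the learner stops after at most `m` queries with an output in `good`,
where each query of a point `x` is answered by a fresh label drawn from `κ x`. -/
def Prog.successProb {X : Type} [MeasurableSpace X] {Out : Type} (κ : Kernel X Bool)
    (good : Set Out) : Prog X Out → ℕ → ℝ≥0∞
  | .ret o, _ => if o ∈ good then 1 else 0
  | .query _ _, 0 => 0
  | .query q next, m + 1 => ∫⁻ x, ∫⁻ y, (next x y).successProb κ good m ∂(κ x) ∂q

/-- A binary hypothesis (`true` is the label `1`). -/
abbrev Hyp (X : Type) : Type := X → Bool

/-- `err(h) = Pr_{(x,y) ∼ J}[h(x) ≠ y]`. -/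
def err {X : Type} [MeasurableSpace X] (J : Measure (X × Bool)) (h : Hyp X) : ℝ :=
  J.real {p | h p.1 ≠ p.2}

/-- The learner `A` solves the instance `(H, D, η, ε, δ)` with `m` queries.  For every joint law `J`
with marginal `D` (with `κ` a version of its conditional law of the label given the point) such
that some hypothesis in `H` has error at most `η`, with probability at least `1 - δ` the learner
uses at most `m` queries and outputs a member of `H` with error at most `η + ε`. -/
def Solves {X : Type} [MeasurableSpace X] (D : Measure X) (H : Set (Hyp X)) (η ε δ : ℝ) (m : ℕ)
    (A : Prog X (Hyp X)) : Prop :=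
  ∀ (J : Measure (X × Bool)) (κ : Kernel X Bool), IsProbabilityMeasure J → IsMarkovKernel κ →
    J.fst = D → J = D ⊗ₘ κ →
    (∃ h ∈ H, err J h ≤ η) →
    ENNReal.ofReal (1 - δ) ≤ A.successProb κ {h | h ∈ H ∧ err J h ≤ η + ε} m

/-! ### The ingredients of the algorithm -/

/-- `‖h - g‖ = Pr_{x ∼ D}[h(x) ≠ g(x)]`. -/
def hdist {X : Type} [MeasurableSpace X] (D : Measure X) (h g : Hyp X) : ℝ :=
  D.real {x | h x ≠ g x}

/-- A finite `r`-separated subset of `H`. -/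
def IsPacking {X : Type} [MeasurableSpace X] (D : Measure X) (H : Set (Hyp X)) (r : ℝ)
    (P : Finset (Hyp X)) : Prop :=
  (∀ h ∈ P, h ∈ H) ∧ ∀ h ∈ P, ∀ g ∈ P, h ≠ g → r < hdist D h g

/-- The ball of radius `r` around `μ`, within the finite class `P`. -/
def ball {X : Type} [MeasurableSpace X] (D : Measure X) (P : Finset (Hyp X)) (μ : Hyp X) (r : ℝ) :
    Finset (Hyp X) :=
  P.filter fun h => hdist D μ h ≤ r

/-- The mass of a finite set of hypotheses. -/
def mass {X : Type} (l : Hyp X → ℝ) (A : Finset (Hyp X)) : ℝ := ∑ h ∈ A, l h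

/-- The normalization `λ` of the weights `w` on `P`. -/
def normalize {X : Type} (P : Finset (Hyp X)) (w : Hyp X → ℝ) (h : Hyp X) : ℝ :=
  w h / mass w P

/-- The capped distribution `λ̄_S`. -/
def capped {X : Type} (l : Hyp X → ℝ) (S : Finset (Hyp X)) (h : Hyp X) : ℝ :=
  if h ∈ S then 1 / 2 * l h else l h * ((1 - 1 / 2 * mass l S) / (1 - mass l S))

/-- `r(x) = min { E_{h ∼ l}[h(x)], 1 - E_{h ∼ l}[h(x)] }`, for `l` on the finite class `P`. -/
def uncertainty {X : Type} (P : Finset (Hyp X)) (l : Hyp X → ℝ) (x : X) : ℝ :=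
  min (mass l (P.filter fun h => h x = true)) (1 - mass l (P.filter fun h => h x = true))

/-- `max_x q(x) / D(x)`: the least `M` with `q ≤ M D`, infinite if there is none. -/
def maxRatio {X : Type} [MeasurableSpace X] (q D : Measure X) : ℝ≥0∞ :=
  sInf {M : ℝ≥0∞ | q ≤ M • D}

/-- `E_{x ∼ q}[r(x)] - c max_x q(x) / D(x)`, for `q` with finite maximal ratio. -/
def objective {X : Type} [MeasurableSpace X] (D : Measure X) (r : X → ℝ) (c : ℝ)
    (q : Measure X) : ℝ :=
  ∫ x, r x ∂q - c * (maxRatio q D).toReal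

/-- `q` maximizes the objective over all probability measures.  Those with infinite maximal ratio
have objective `-∞` (for `c > 0`) and do not compete. -/
def IsOptimalQuery {X : Type} [MeasurableSpace X] (D : Measure X) (r : X → ℝ) (c : ℝ)
    (q : Measure X) : Prop :=
  IsProbabilityMeasure q ∧ maxRatio q D ≠ ⊤ ∧
    ∀ q' : Measure X, IsProbabilityMeasure q' → maxRatio q' D ≠ ⊤ →
      objective D r c q' ≤ objective D r c q

/-- Some ball of radius `R` centered in `P` has probability more than 80% under `l`. -/
def HasHeavyBall {X : Type} [MeasurableSpace X] (D : Measure X) (P : Finset (Hyp X))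
    (l : Hyp X → ℝ) (R : ℝ) : Prop :=
  ∃ μ ∈ P, 4 / 5 < mass l (ball D P μ R)

/-- `μ` is the center of a heaviest ball of radius `R` under `l`. -/
def IsHeaviestCenter {X : Type} [MeasurableSpace X] (D : Measure X) (P : Finset (Hyp X))
    (l : Hyp X → ℝ) (R : ℝ) (μ : Hyp X) : Prop :=
  μ ∈ P ∧ ∀ ν ∈ P, mass l (ball D P ν R) ≤ mass l (ball D P μ R)

/-- The radius `c₄ η + c₅ ε`. -/
def radius (c₄ c₅ η ε : ℝ) : ℝ := c₄ * η + c₅ * ε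

/-- The noise level `3 η + 3 (c₄ η + c₅ ε)` with which the second stage is run. -/
def noise₂ (c₄ c₅ η ε : ℝ) : ℝ := 3 * η + 3 * radius c₄ c₅ η ε

/-- The choices that the pseudo-code leaves open: which maximal packing, which heaviest ball, which
optimal query distribution, and, in the second stage, which pair of far candidates is compared next
and which surviving candidate is returned.  Any choices that meet these specifications are
allowed. -/
structure Choices {X : Type} [MeasurableSpace X] (D : Measure X) (H : Set (Hyp X))
    (c₄ c₅ η ε : ℝ) where
  /-- the maximal `2η`-packing `H'` of `H` -/
  pack : Finset (Hyp X)
  pack_spec : Maximal (IsPacking D H (2 * η)) pack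
  /-- the center of a heaviest ball, given the distribution `λ` -/
  center : (Hyp X → ℝ) → Hyp X
  center_spec : ∀ l, IsHeaviestCenter D pack l (radius c₄ c₅ η ε) (center l)
  /-- the query distribution `q*`, given the capped distribution `λ̄` -/
  queryDist : (Hyp X → ℝ) → Measure X
  queryDist_spec : ∀ l, IsOptimalQuery D (uncertainty pack l) (c₄ / 20 * η) (queryDist l)
  /-- a pair of candidates at distance at least three times the noise level, if there is one -/
  pair : Finset (Hyp X) → Hyp X × Hyp X
  pair_spec : ∀ F : Finset (Hyp X),
    (∃ h ∈ F, ∃ g ∈ F, 3 * noise₂ c₄ c₅ η ε ≤ hdist D h g) →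
      (pair F).1 ∈ F ∧ (pair F).2 ∈ F ∧
        3 * noise₂ c₄ c₅ η ε ≤ hdist D (pair F).1 (pair F).2
  /-- a remaining candidate -/
  out : Finset (Hyp X) → Hyp X
  out_spec : ∀ F : Finset (Hyp X), F.Nonempty → out F ∈ F

/-- The state of the first stage: weights, high-density region, centers found so far. -/
structure State (X : Type) where
  w : Hyp X → ℝ
  S : Finset (Hyp X)
  C : Finset (Hyp X)

/-- The learning rate. -/
def α : ℝ := 1 / 5

/-- The multiplicative update of the weights of `h ∈ P` on seeing the label `y` at `x`. -/
def reweight {X : Type} (P : Finset (Hyp X)) (w : Hyp X → ℝ) (x : X) (y : Bool) (h : Hyp X) : ℝ :=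
  if h ∈ P ∧ h x ≠ y then Real.exp (-α) * w h else w h

section Algorithm

variable {X : Type} [MeasurableSpace X] {D : Measure X} {H : Set (Hyp X)} {c₄ c₅ η ε : ℝ}

/-- The part of a round before the query: if the capped distribution has a heavy ball, the ball
of three times the radius around the center `μ'` of the heaviest ball is added to `S`, and `μ'` is
added to `C`. -/
def expand (ch : Choices D H c₄ c₅ η ε) (s : State X) : State X :=
  if HasHeavyBall D ch.pack (capped (normalize ch.pack s.w) s.S) (radius c₄ c₅ η ε) then
    { w := s.w
      S := s.S ∪ ball D ch.pack (ch.center (normalize ch.pack s.w)) (3 * radius c₄ c₅ η ε)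
      C := insert (ch.center (normalize ch.pack s.w)) s.C }
  else s

/-- The first stage, with a given number of rounds left. -/
def stage₁ (ch : Choices D H c₄ c₅ η ε) : ℕ → State X → Prog X (State X)
  | 0, s => .ret s
  | n + 1, s =>
    let s' := expand ch s
    .query (ch.queryDist (capped (normalize ch.pack s'.w) s'.S)) fun x y =>
      stage₁ ch n { w := reweight ch.pack s'.w x y, S := s'.S, C := s'.C }

/-- Query `n` independent points drawn from `q`, and return `e` plus the number of labels
that `h` gets wrong. -/
def countErrors (q : Measure X) (h : Hyp X) : ℕ → ℕ → Prog X ℕ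
  | 0, e => .ret e
  | n + 1, e => .query q fun x y => countErrors q h n (if h x ≠ y then e + 1 else e)

/-- The second stage, on the set `F` of remaining candidates: as long as there are two candidates
`h`, `h'` at distance at least three times the noise level, query `t` points drawn from `D`
conditioned on `h(x) ≠ h'(x)` and remove the one of the two that is wrong on at least half of them.
The first argument bounds the number of comparisons; the cardinality of the initial set is always
enough. -/
def stage₂ (ch : Choices D H c₄ c₅ η ε) (t : ℕ) : ℕ → Finset (Hyp X) → Prog X (Hyp X)
  | 0, F => .ret (ch.out F)
  | n + 1, F =>
    if ∃ h ∈ F, ∃ g ∈ F, 3 * noise₂ c₄ c₅ η ε ≤ hdist D h g then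
      (countErrors (cond D {x | (ch.pair F).1 x ≠ (ch.pair F).2 x}) (ch.pair F).1 t 0).bind
        fun e => stage₂ ch t n (F.erase (if t ≤ 2 * e then (ch.pair F).1 else (ch.pair F).2))
    else .ret (ch.out F)

/-- The competitive algorithm for active agnostic learning: `⌈K₁ log(|H'|/δ)⌉` rounds of
the first stage, then the second stage on the centers `C`, with `⌈K₂ log(|C|/δ)⌉` queries per
comparison. -/
def competitiveAlgorithm (ch : Choices D H c₄ c₅ η ε) (K₁ K₂ δ : ℝ) : Prog X (Hyp X) :=
  (stage₁ ch ⌈K₁ * Real.log (ch.pack.card / δ)⌉₊ { w := fun _ => 1, S := ∅, C := ∅ }).bind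
    fun s => stage₂ ch ⌈K₂ * Real.log (s.C.card / δ)⌉₊ s.C.card s.C

end Algorithm

/-! ### Threshold functions -/

/-- The hypotheses `h_τ(x) = 1_{x ≥ τ}` for `τ ∈ T`. -/
def thresholds (T : Set ℝ) : Set (Hyp ℝ) :=
  (fun τ : ℝ => fun x : ℝ => decide (τ ≤ x)) '' T

/-- The logarithm, read as `max {1, log t}` inside asymptotic bounds. -/
def lg (t : ℝ) : ℝ := max 1 (Real.log t)

end

end ActiveLearning

open MeasureTheory ProbabilityTheory
open scoped ENNReal

namespace ActiveLearning

noncomputable section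

open scoped Classical

/-! ### Success probabilities -/

section Prog

variable {X : Type} [MeasurableSpace X] {Out : Type} {κ : Kernel X Bool} {good : Set Out}

/-! Let `h` have error at most `η`. A maximal packing contains `g` within `2η'` of `h`, so `g` has
error at most `3η'`. The first stage has to cover `g` by `S`; the second has to keep a center near
`g` among the candidates.

First stage. While `g` is uncovered, follow the potential `√(w(P) w(P \ S)) / w(g)`. It starts at
`|P|`, is at least 1, and does not grow when `S` does. The capped distribution averages `λ` and `λ`
conditioned off `S`. Hence, whatever the label, the mean of the wrong fractions of `P` and `P \ S`
is at least the uncertainty `r(x)`, and by AM-GM the square root shrinks by a factor `1 - r(x)/6`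
(`potential_reweight_le`). An error of `g` adds at most `1/4` to that factor. Its probability is at
most the density ratio of the query distribution times the error of `g`, which the penalty in the
objective pays for (`lintegral_update_le`). So an objective of at least `1/20` contracts the
potential in expectation by `119/120`.

Such an objective is always available. After the expansion step no ball is heavy for the capped
distribution (`not_hasHeavyBall_capped_union`). For thresholds this makes the set of points of
uncertainty at least `1/10` have probability above `R` (`lt_measureReal_uncertain`), and `D`
conditioned on that set is a good competitor. Thus `g` is covered except with probability about `|P|
(119/120)^n`, and then some center `μ` is within `3R` of it and has error at most `ν = noise₂`.

Second stage. On a disagreement region of probability at least `3ν`, `μ` is wrong with conditional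
probability at most `1/3`, so a Chernoff bound protects it in every comparison
(`one_le_successProb_comparison`). There are at most `|C| - 1` comparisons. Any final candidate is
within `3ν` of `μ`, so its error is at most `4ν ≤ η + ε`.

Query count. The distribution function of `D` bounds the packing by `1 + 1/(2η')`, so there are
`O(log(1/(εδ)))` rounds. Each round adds at most one center, so a comparison costs
`O(log(log(1/ε)/δ))`. -/

theorem Prog.successProb_mono (A : Prog X Out) {m m' : ℕ} (h : m ≤ m') :
    A.successProb κ good m ≤ A.successProb κ good m' := by
  induction A generalizing m m' with
  | ret o => simp [Prog.successProb]
  | query q next ih =>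
    cases m with
    | zero => simp [Prog.successProb]
    | succ m =>
      obtain ⟨m', rfl⟩ : ∃ k, m' = k + 1 := ⟨m' - 1, by omega⟩
      simp only [Prog.successProb]
      exact lintegral_mono fun x => lintegral_mono fun y => ih x y (by omega)

/-- A bound on the failure probability of every continuation of a query integrates to a bound on the
failure probability of the query.  No measurability of the success probabilities is needed. -/
theorem Prog.one_le_successProb_query [IsMarkovKernel κ] (q : Measure X) [IsProbabilityMeasure q]
    (next : X → Bool → Prog X Out) (m : ℕ) (V : X → Bool → ℝ≥0∞)
    (hV : Measurable (Function.uncurry V)) (B : ℝ≥0∞)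
    (h : ∀ x y, 1 ≤ (next x y).successProb κ good m + (V x y + B)) :
    1 ≤ (Prog.query q next).successProb κ good (m + 1) +
      ((∫⁻ x, ∫⁻ y, V x y ∂(κ x) ∂q) + B) := by
  have hV' : Measurable fun x => ∫⁻ y, V x y ∂(κ x) := hV.lintegral_kernel_prod_right
  calc (1 : ℝ≥0∞) = ∫⁻ _x, ∫⁻ _y, 1 ∂(κ _x) ∂q := by
        simp only [lintegral_const, measure_univ, mul_one]
    _ ≤ ∫⁻ x, ∫⁻ y, ((next x y).successProb κ good m + (V x y + B)) ∂(κ x) ∂q :=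
        lintegral_mono fun x => lintegral_mono fun y => h x y
    _ = ∫⁻ x, ((∫⁻ y, (next x y).successProb κ good m ∂(κ x)) +
          ((∫⁻ y, V x y ∂(κ x)) + B)) ∂q := by
        refine lintegral_congr fun x => ?_
        rw [lintegral_add_right _ (measurable_of_finite _),
          lintegral_add_right _ measurable_const]
        simp only [lintegral_const, measure_univ, mul_one]
    _ = _ := by
        -- Splitting a lower integral needs measurability of one summand only. This is why failure
        -- bounds are carried additively, as `1 ≤ success + failure`.
        rw [lintegral_add_right _ (hV'.add_const B), lintegral_add_right _ measurable_const]
        simp [Prog.successProb]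

end Prog

/-! ### Errors and distances -/

section Distance

variable {X : Type} [MeasurableSpace X] {D : Measure X}

theorem hdist_comm (h g : Hyp X) : hdist D h g = hdist D g h := by
  simp only [hdist, ne_comm]

theorem hdist_self (h : Hyp X) : hdist D h h = 0 := by simp [hdist]

theorem hdist_triangle [IsFiniteMeasure D] (f g h : Hyp X) :
    hdist D f h ≤ hdist D f g + hdist D g h := by
  refine (measureReal_mono ?_).trans (measureReal_union_le _ _)
  intro x hx
  by_contra hc
  simp only [Set.mem_union, Set.mem_ofPred_eq, not_or, not_not] at hc hx
  exact hx (hc.1.trans hc.2)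

theorem measurableSet_hyp_ne {h g : Hyp X} (hh : Measurable h) (hg : Measurable g) :
    MeasurableSet {x | h x ≠ g x} :=
  (measurableSet_eq_fun hh hg).compl

theorem measurableSet_wrong {h : Hyp X} (hh : Measurable h) :
    MeasurableSet {p : X × Bool | h p.1 ≠ p.2} :=
  (measurableSet_eq_fun (hh.comp measurable_fst) measurable_snd).compl

theorem err_le_err_add_hdist {J : Measure (X × Bool)} [IsFiniteMeasure J] (hJ : J.fst = D)
    {h g : Hyp X} (hh : Measurable h) (hg : Measurable g) :
    err J h ≤ err J g + hdist D h g := by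
  have e : hdist D h g = J.real (Prod.fst ⁻¹' {x | h x ≠ g x}) := by
    rw [hdist, ← hJ, measureReal_def, Measure.fst_apply (measurableSet_hyp_ne hh hg),
      measureReal_def]
  rw [e]
  refine (measureReal_mono ?_).trans (measureReal_union_le _ _)
  intro p hp
  by_contra hc
  simp only [Set.mem_union, Set.mem_ofPred_eq, Set.mem_preimage, not_or, not_not] at hc hp
  exact hp (hc.2.trans hc.1)

/-- The probability that `h` is wrong under queries from `q` is at most the maximal ratio of `q` to
`D` times the error of `h`. -/
theorem lintegral_wrong_le {κ : Kernel X Bool} [IsMarkovKernel κ] [IsProbabilityMeasure D]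
    {q : Measure X} {M : ℝ≥0∞} (hq : q ≤ M • D) {h : Hyp X} (hh : Measurable h) :
    ∫⁻ x, κ x {y | h x ≠ y} ∂q ≤ M * ENNReal.ofReal (err (D ⊗ₘ κ) h) := by
  calc ∫⁻ x, κ x {y | h x ≠ y} ∂q ≤ ∫⁻ x, κ x {y | h x ≠ y} ∂(M • D) := lintegral_mono' hq le_rfl
    _ = M * ENNReal.ofReal (err (D ⊗ₘ κ) h) := by
      rw [lintegral_smul_measure, err, ofReal_measureReal,
        Measure.compProd_apply (measurableSet_wrong hh)]
      rfl

end Distance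

/-! ### The maximal ratio -/

section MaxRatio

variable {X : Type} [MeasurableSpace X] {D : Measure X}

theorem maxRatio_le {q : Measure X} {M : ℝ≥0∞} (h : q ≤ M • D) : maxRatio q D ≤ M := sInf_le h

/-- The infimum is attained. On a set `s` with `D s ≠ 0` every admissible `M` is at least `q s / D
s`, hence so is the infimum. If `D s = 0`, any admissible `M` forces `q s = 0`. -/
theorem le_maxRatio_smul [IsFiniteMeasure D] {q : Measure X} (h : maxRatio q D ≠ ⊤) :
    q ≤ maxRatio q D • D := by
  refine Measure.le_iff.2 fun s _ => ?_
  have hne : {M : ℝ≥0∞ | q ≤ M • D}.Nonempty := by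
    by_contra hc
    rw [Set.not_nonempty_iff_eq_empty] at hc
    exact h (by rw [maxRatio, hc, sInf_empty])
  obtain ⟨M₀, hM₀⟩ := hne
  simp only [Measure.smul_apply, smul_eq_mul]
  by_cases hs : D s = 0
  · have := hM₀ s
    simp only [Measure.smul_apply, smul_eq_mul, hs, mul_zero] at this
    simpa [hs] using this
  · rw [← ENNReal.div_le_iff hs (measure_ne_top D s)]
    refine le_sInf fun M hM => ?_
    rw [ENNReal.div_le_iff hs (measure_ne_top D s)]
    simpa using hM s

theorem cond_le_smul (A : Set X) : ProbabilityTheory.cond D A ≤ (D A)⁻¹ • D := by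
  rw [ProbabilityTheory.cond]
  exact Measure.le_iff.2 fun s _ => by
    simp only [Measure.smul_apply, smul_eq_mul]
    gcongr
    exact Measure.restrict_le_self

end MaxRatio

/-! ### Existence of an optimal query distribution -/

section OptimalQuery

variable {X : Type} [MeasurableSpace X] {D : Measure X}

theorem integral_comp_eq_sum {ι : Type*} [Fintype ι] [MeasurableSpace ι]
    [MeasurableSingletonClass ι] {π : X → ι} (hπ : Measurable π) (G : ι → ℝ)
    (q : Measure X) [IsFiniteMeasure q] :
    ∫ x, G (π x) ∂q = ∑ i, G i * q.real (π ⁻¹' {i}) := by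
  rw [← integral_map (f := G) hπ.aemeasurable (measurable_of_finite G).aestronglyMeasurable,
    integral_fintype Integrable.of_finite]
  refine Finset.sum_congr rfl fun i _ => ?_
  rw [smul_eq_mul, mul_comm, map_measureReal_apply hπ (measurableSet_singleton i)]

/-- For a function that factors through a finite measurable partition, an optimal query
distribution exists: replacing a density by its averages over the cells does not decrease the
objective, and what remains is the maximum of a continuous function on a compact set. -/
theorem exists_isOptimalQuery_comp {ι : Type*} [Fintype ι] [MeasurableSpace ι]
    [MeasurableSingletonClass ι] [IsProbabilityMeasure D] {π : X → ι} (hπ : Measurable π)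
    (G : ι → ℝ) {c : ℝ} (hc : 0 ≤ c) : ∃ q, IsOptimalQuery D (fun x => G (π x)) c q := by
  obtain ⟨x₀⟩ : Nonempty X := nonempty_of_isProbabilityMeasure D
  have : Nonempty ι := ⟨π x₀⟩
  have hcell : ∀ i, MeasurableSet (π ⁻¹' {i}) := fun i => hπ (measurableSet_singleton i)
  have sum_cells : ∀ q : Measure X, IsProbabilityMeasure q → ∑ i, q.real (π ⁻¹' {i}) = 1 := by
    intro q _
    have := integral_comp_eq_sum hπ (fun _ => (1 : ℝ)) q
    simpa using this.symm
  set d : ι → ℝ := fun i => D.real (π ⁻¹' {i}) with hd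
  have hd0 : ∀ i, 0 ≤ d i := fun i => measureReal_nonneg
  -- Cell masses of probability measures with finite ratio. Null cells must be excluded by hand,
  -- since `p i / 0 = 0` would let them carry mass for free.
  set K : Set (ι → ℝ) := stdSimplex ℝ ι ∩ {p | ∀ i, d i = 0 → p i = 0} with hK
  have hKc : IsCompact K := by
    refine (isCompact_stdSimplex ℝ ι).inter_right ?_
    have : {p : ι → ℝ | ∀ i, d i = 0 → p i = 0} = ⋂ i, ⋂ (_ : d i = 0), {p | p i = 0} := by
      ext p; simp
    rw [this]
    exact isClosed_iInter fun i => isClosed_iInter fun _ =>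
      isClosed_eq (continuous_apply i) continuous_const
  have hKne : K.Nonempty := ⟨d, ⟨hd0, sum_cells D inferInstance⟩, fun i h => h⟩
  set top : (ι → ℝ) → ℝ := fun p => Finset.univ.sup' Finset.univ_nonempty fun i => p i / d i
    with htop
  have hcont : Continuous fun p : ι → ℝ => ∑ i, G i * p i - c * top p := by
    refine Continuous.sub (by fun_prop) (continuous_const.mul ?_)
    exact Continuous.finset_sup'_apply _ fun i _ => by fun_prop
  obtain ⟨p, hpK, hpmax⟩ := hKc.exists_isMaxOn hKne hcont.continuousOn
  have hp0 : ∀ i, 0 ≤ p i := hpK.1.1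
  have htop0 : 0 ≤ top p :=
    (div_nonneg (hp0 (π x₀)) (hd0 _)).trans
      (Finset.le_sup' (fun i => p i / d i) (Finset.mem_univ (π x₀)))
  set q : Measure X := D.withDensity fun x => ENNReal.ofReal (p (π x) / d (π x)) with hq
  have hqcell : ∀ i, q (π ⁻¹' {i}) = ENNReal.ofReal (p i) := by
    intro i
    rw [hq, withDensity_apply _ (hcell i)]
    have : ∫⁻ x in π ⁻¹' {i}, ENNReal.ofReal (p (π x) / d (π x)) ∂D =
        ∫⁻ x in π ⁻¹' {i}, ENNReal.ofReal (p i / d i) ∂D :=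
      setLIntegral_congr_fun (hcell i) fun x hx => by
        have : π x = i := hx
        simp only [this]
    rw [this, setLIntegral_const, ← ofReal_measureReal,
      ← ENNReal.ofReal_mul (div_nonneg (hp0 i) (hd0 i))]
    congr 1
    by_cases h0 : d i = 0
    · rw [hpK.2 i h0]; simp
    · exact div_mul_cancel₀ _ h0
  have hqprob : IsProbabilityMeasure q := by
    refine ⟨?_⟩
    have : (Set.univ : Set X) = ⋃ i ∈ (Finset.univ : Finset ι), π ⁻¹' {i} := by ext x; simp
    rw [this, measure_biUnion_finset _ fun i _ => hcell i]
    · simp only [hqcell]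
      rw [← ENNReal.ofReal_sum_of_nonneg fun i _ => hp0 i, hpK.1.2, ENNReal.ofReal_one]
    · intro i _ j _ hij
      exact Disjoint.preimage π (by simpa using hij)
  have hqle : q ≤ ENNReal.ofReal (top p) • D := by
    rw [hq, ← withDensity_const]
    refine withDensity_mono (ae_of_all _ fun x => ENNReal.ofReal_le_ofReal ?_)
    exact Finset.le_sup' (fun i => p i / d i) (Finset.mem_univ (π x))
  have hqratio : maxRatio q D ≤ ENNReal.ofReal (top p) := maxRatio_le hqle
  refine ⟨q, hqprob, ne_top_of_le_ne_top ENNReal.ofReal_ne_top hqratio, fun q' hq' hfin => ?_⟩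
  have hle' := le_maxRatio_smul hfin
  have hcell' : ∀ i, q'.real (π ⁻¹' {i}) ≤ (maxRatio q' D).toReal * d i := by
    intro i
    have h1 : q' (π ⁻¹' {i}) ≤ maxRatio q' D * D (π ⁻¹' {i}) := by simpa using hle' (π ⁻¹' {i})
    change (q' _).toReal ≤ _ * (D _).toReal
    rw [← ENNReal.toReal_mul]
    exact ENNReal.toReal_mono (ENNReal.mul_ne_top hfin (measure_ne_top _ _)) h1
  have hp'K : (fun i => q'.real (π ⁻¹' {i})) ∈ K := by
    refine ⟨⟨fun i => measureReal_nonneg, sum_cells q' hq'⟩, fun i h0 => ?_⟩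
    refine le_antisymm ?_ measureReal_nonneg
    simpa [h0] using hcell' i
  -- Averaging over cells keeps the integral of a function constant on cells and does not raise the
  -- maximal ratio.
  have htop' : top (fun i => q'.real (π ⁻¹' {i})) ≤ (maxRatio q' D).toReal := by
    refine Finset.sup'_le _ _ fun i _ => ?_
    exact div_le_of_le_mul₀ (hd0 i) ENNReal.toReal_nonneg (hcell' i)
  have hqtop : (maxRatio q D).toReal ≤ top p :=
    ENNReal.toReal_le_of_le_ofReal htop0 hqratio
  have key := hpmax hp'K
  simp only [Set.mem_ofPred_eq] at key
  have hqreal : ∀ i, q.real (π ⁻¹' {i}) = p i := fun i => by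
    rw [measureReal_def, hqcell, ENNReal.toReal_ofReal (hp0 i)]
  simp only [objective]
  rw [integral_comp_eq_sum hπ G q', integral_comp_eq_sum hπ G q]
  simp only [hqreal]
  have e1 := mul_le_mul_of_nonneg_left htop' hc
  have e2 := mul_le_mul_of_nonneg_left hqtop hc
  linarith

/-- The values on `x` of the hypotheses in `P`. -/
def labelPattern (P : Finset (Hyp X)) (x : X) : P → Bool := fun h => h.1 x

theorem measurable_labelPattern {P : Finset (Hyp X)} (hP : ∀ h ∈ P, Measurable h) :
    Measurable (labelPattern P) :=
  measurable_pi_iff.2 fun h => hP h.1 h.2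

/-- The uncertainty as a function of the label pattern. -/
def patternUncertainty (P : Finset (Hyp X)) (l : Hyp X → ℝ) (b : P → Bool) : ℝ :=
  min (∑ h : P, if b h = true then l h else 0) (1 - ∑ h : P, if b h = true then l h else 0)

theorem uncertainty_eq_patternUncertainty {X : Type} (P : Finset (Hyp X)) (l : Hyp X → ℝ) :
    uncertainty P l = fun x => patternUncertainty P l (labelPattern P x) := by
  funext x
  have : mass l (P.filter fun h => h x = true) =
      ∑ h : P, if labelPattern P x h = true then l h else 0 := by
    rw [mass, Finset.sum_filter]
    exact (Finset.sum_coe_sort P fun h => if h x = true then l h else 0).symm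
  simp only [uncertainty, patternUncertainty, this]

theorem exists_isOptimalQuery [IsProbabilityMeasure D] {P : Finset (Hyp X)}
    (hP : ∀ h ∈ P, Measurable h) (l : Hyp X → ℝ) {c : ℝ} (hc : 0 ≤ c) :
    ∃ q, IsOptimalQuery D (uncertainty P l) c q := by
  rw [uncertainty_eq_patternUncertainty]
  exact exists_isOptimalQuery_comp (measurable_labelPattern hP) _ hc

theorem measurable_uncertainty {P : Finset (Hyp X)} (hP : ∀ h ∈ P, Measurable h)
    (l : Hyp X → ℝ) : Measurable (uncertainty P l) := by
  rw [uncertainty_eq_patternUncertainty]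
  exact (measurable_of_finite (patternUncertainty P l)).comp (measurable_labelPattern hP)

theorem integrable_uncertainty {P : Finset (Hyp X)} (hP : ∀ h ∈ P, Measurable h)
    (l : Hyp X → ℝ) (q : Measure X) [IsFiniteMeasure q] : Integrable (uncertainty P l) q := by
  rw [uncertainty_eq_patternUncertainty]
  have := Measure.isFiniteMeasure_map q (labelPattern P)
  exact (integrable_map_measure (measurable_of_finite (patternUncertainty P l)).aestronglyMeasurable
    (measurable_labelPattern hP).aemeasurable).1 Integrable.of_finite

end OptimalQuery

/-! ### Masses -/

section Mass

variable {X : Type} {l : Hyp X → ℝ}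

theorem mass_mono {A B : Finset (Hyp X)} (hAB : A ⊆ B) (hl : ∀ h ∈ B, 0 ≤ l h) :
    mass l A ≤ mass l B :=
  Finset.sum_le_sum_of_subset_of_nonneg hAB fun h hB _ => hl h hB

theorem mass_nonneg {A : Finset (Hyp X)} (hl : ∀ h ∈ A, 0 ≤ l h) : 0 ≤ mass l A :=
  Finset.sum_nonneg hl

theorem mass_filter_add_mass_filter_not (l : Hyp X → ℝ) (A : Finset (Hyp X))
    (p : Hyp X → Prop) [DecidablePred p] [DecidablePred fun h => ¬ p h] :
    mass l (A.filter p) + mass l (A.filter fun h => ¬ p h) = mass l A :=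
  Finset.sum_filter_add_sum_filter_not A p l

theorem mass_sdiff_add {A B : Finset (Hyp X)} (l : Hyp X → ℝ) (h : A ⊆ B) :
    mass l (B \ A) + mass l A = mass l B :=
  Finset.sum_sdiff h

theorem mass_union_le {A B : Finset (Hyp X)} (hB : ∀ h ∈ A ∪ B, 0 ≤ l h) :
    mass l (A ∪ B) ≤ mass l A + mass l B := by
  have h1 : mass l (A ∪ B) + mass l (A ∩ B) = mass l A + mass l B := Finset.sum_union_inter
  have h2 : 0 ≤ mass l (A ∩ B) := mass_nonneg fun h hh =>
    hB h (Finset.mem_union_left _ (Finset.mem_inter.1 hh).1)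
  linarith

end Mass

/-! ### Thresholds -/

section Thresholds

variable {D : Measure ℝ} {T : Set ℝ}

theorem measurable_of_mem_thresholds {h : Hyp ℝ} (hh : h ∈ thresholds T) : Measurable h := by
  obtain ⟨τ, _, rfl⟩ := hh
  refine measurable_to_bool ?_
  have : (fun x : ℝ => decide (τ ≤ x)) ⁻¹' {true} = Set.Ici τ := by ext x; simp
  rw [this]
  exact measurableSet_Ici

/-- A threshold of the hypothesis `h`, if it has one. -/
def threshold (h : Hyp ℝ) : ℝ := if H : ∃ τ : ℝ, h = fun x => decide (τ ≤ x) then H.choose else 0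

theorem eq_threshold {h : Hyp ℝ} (hh : h ∈ thresholds T) (x : ℝ) :
    h x = decide (threshold h ≤ x) := by
  have H : ∃ τ : ℝ, h = fun x => decide (τ ≤ x) := by
    obtain ⟨τ, _, rfl⟩ := hh
    exact ⟨τ, rfl⟩
  have := H.choose_spec
  rw [threshold, dif_pos H]
  exact congrFun this x

theorem thresholds_ne_set {h g : Hyp ℝ} (hh : h ∈ thresholds T) (hg : g ∈ thresholds T)
    (hle : threshold h ≤ threshold g) :
    {x | h x ≠ g x} = Set.Ico (threshold h) (threshold g) := by
  ext x
  simp only [Set.mem_ofPred_eq, eq_threshold hh, eq_threshold hg, Set.mem_Ico, ne_eq,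
    decide_eq_decide]
  constructor
  · intro hx
    by_contra hc
    rw [not_and_or, not_le, not_lt] at hc
    rcases hc with hc | hc
    · exact hx ⟨fun h1 => absurd h1 (not_le.2 hc), fun h1 => hle.trans h1⟩
    · exact hx ⟨fun _ => hc, fun h1 => hle.trans h1⟩
  · rintro ⟨h1, h2⟩ h3
    exact absurd (h3.1 h1) (not_le.2 h2)

/-- The map from a threshold to the probability below it preserves distances, so packing thresholds
amounts to packing points of an interval. -/
theorem hdist_thresholds [IsFiniteMeasure D] {h g : Hyp ℝ} (hh : h ∈ thresholds T)
    (hg : g ∈ thresholds T) :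
    hdist D h g = |D.real (Set.Iio (threshold h)) - D.real (Set.Iio (threshold g))| := by
  wlog hle : threshold h ≤ threshold g generalizing h g
  · rw [hdist_comm, this hg hh (le_of_not_ge hle), abs_sub_comm]
  have : Set.Ico (threshold h) (threshold g) =
      Set.Iio (threshold g) \ Set.Iio (threshold h) := by
    ext x; simp
  rw [hdist, thresholds_ne_set hh hg hle, this,
    measureReal_sdiff (Set.Iio_subset_Iio hle) measurableSet_Iio, abs_sub_comm, abs_of_nonneg]
  exact sub_nonneg.2 (measureReal_mono (Set.Iio_subset_Iio hle))

/-- A packing of thresholds at scale `r` has at most `1 + 1 / r` members. -/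
theorem IsPacking.card_le [IsProbabilityMeasure D] {r : ℝ} (hr : 0 < r) {P : Finset (Hyp ℝ)}
    (hP : IsPacking D (thresholds T) r P) : (P.card : ℝ) ≤ 1 + 1 / r := by
  set F : Hyp ℝ → ℝ := fun h => D.real (Set.Iio (threshold h)) with hF
  have hF0 : ∀ h, 0 ≤ F h / r := fun h => div_nonneg measureReal_nonneg hr.le
  have hcard : P.card ≤ (Finset.range (⌊1 / r⌋₊ + 1)).card := by
    -- Two members with the same floor would be at distance less than `r`.
    refine Finset.card_le_card_of_injOn (fun h => ⌊F h / r⌋₊) (fun h _ => ?_) ?_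
    · have : ⌊F h / r⌋₊ ≤ ⌊1 / r⌋₊ :=
        Nat.floor_le_floor (div_le_div_of_nonneg_right measureReal_le_one hr.le)
      simpa [Nat.lt_succ_iff] using this
    · intro h hh g hg heq
      by_contra hne
      have hd := hP.2 h hh g hg hne
      rw [hdist_thresholds (hP.1 h hh) (hP.1 g hg)] at hd
      simp only at heq
      have a1 := Nat.floor_le (hF0 h)
      have a2 := Nat.lt_floor_add_one (F h / r)
      have b1 := Nat.floor_le (hF0 g)
      have b2 := Nat.lt_floor_add_one (F g / r)
      rw [heq] at a1 a2
      have : |F h / r - F g / r| < 1 := by rw [abs_lt]; constructor <;> linarith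
      rw [← sub_div, abs_div, abs_of_pos hr, div_lt_one hr] at this
      exact absurd hd (not_lt.2 this.le)
  rw [Finset.card_range] at hcard
  have h1 : (P.card : ℝ) ≤ (⌊1 / r⌋₊ : ℝ) + 1 := by exact_mod_cast hcard
  have h2 := Nat.floor_le (show (0 : ℝ) ≤ 1 / r by positivity)
  linarith

/-- Cardinalities of packings are bounded, and a packing of largest cardinality is maximal for
inclusion. -/
theorem exists_maximal_packing [IsProbabilityMeasure D] {r : ℝ} (hr : 0 < r) :
    ∃ P, Maximal (IsPacking D (thresholds T) r) P := by
  have hbdd : ∀ P, IsPacking D (thresholds T) r P → P.card ≤ ⌊1 + 1 / r⌋₊ := fun P hP =>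
    Nat.le_floor (hP.card_le hr)
  obtain ⟨P, hP, hcard⟩ := Nat.findGreatest_spec
    (P := fun n => ∃ P, IsPacking D (thresholds T) r P ∧ P.card = n)
    (Nat.zero_le ⌊1 + 1 / r⌋₊) ⟨∅, ⟨by simp, by simp⟩, rfl⟩
  refine ⟨P, hP, fun Q hQ hPQ => ?_⟩
  have := Nat.le_findGreatest (P := fun n => ∃ P, IsPacking D (thresholds T) r P ∧ P.card = n)
    (hbdd Q hQ) ⟨Q, hQ, rfl⟩
  exact (Finset.eq_of_subset_of_card_le hPQ (hcard ▸ this)).ge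

/-- In a maximal packing every hypothesis has a close member. -/
theorem Maximal.exists_hdist_le {X : Type} [MeasurableSpace X] {D : Measure X}
    {H : Set (Hyp X)} {r : ℝ} (hr : 0 ≤ r)
    {P : Finset (Hyp X)} (hP : Maximal (IsPacking D H r) P) {h : Hyp X} (hh : h ∈ H) :
    ∃ g ∈ P, hdist D g h ≤ r := by
  by_contra! hc
  have hQ : IsPacking D H r (insert h P) := by
    refine ⟨fun f hf => ?_, fun f hf g hg hne => ?_⟩
    · rcases Finset.mem_insert.1 hf with rfl | hf
      exacts [hh, hP.1.1 f hf]
    · rcases Finset.mem_insert.1 hf with hf | hf <;> rcases Finset.mem_insert.1 hg with hg | hg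
      · exact absurd (hf.trans hg.symm) hne
      · rw [hf, hdist_comm]; exact hc g hg
      · rw [hg]; exact hc f hf
      · exact hP.1.2 f hf g hg hne
  have hmem : h ∈ P := hP.2 hQ (Finset.subset_insert h P) (Finset.mem_insert_self h P)
  have := hc h hmem
  rw [hdist_self] at this
  linarith

/-- If no ball of radius `R` is heavy for the distribution `l` on a finite set of thresholds, then
the points of uncertainty at least `1/10` have probability more than `R`. -/
theorem lt_measureReal_uncertain [IsProbabilityMeasure D] {P : Finset (Hyp ℝ)}
    (hP : ∀ h ∈ P, h ∈ thresholds T) {l : Hyp ℝ → ℝ} (hl : ∀ h ∈ P, 0 ≤ l h)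
    (hl1 : mass l P = 1) {R : ℝ} (hR : ¬ HasHeavyBall D P l R) :
    R < D.real {x | 1 / 10 ≤ uncertainty P l x} := by
  set F : ℝ → ℝ := fun x => mass l (P.filter fun h => threshold h ≤ x) with hF
  set F' : ℝ → ℝ := fun x => mass l (P.filter fun h => threshold h < x) with hF'
  have hunc : ∀ x, uncertainty P l x = min (F x) (1 - F x) := by
    intro x
    have : P.filter (fun h => h x = true) = P.filter fun h => threshold h ≤ x :=
      Finset.filter_congr fun h hh => by rw [eq_threshold (hP h hh)]; simp
    simp only [uncertainty, this, hF]
  -- The two tails in the order of thresholds. The largest threshold in `Lo` and the smallest in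
  -- `Hi` show that each tail has mass at most `1/10`. Using both `F` and its strict version `F'`
  -- accommodates atoms.
  set Lo := P.filter fun h => F (threshold h) < 1 / 10 with hLo
  set Hi := P.filter fun h => 9 / 10 ≤ F' (threshold h) with hHi
  have mLo : mass l Lo < 1 / 10 := by
    rcases Lo.eq_empty_or_nonempty with he | hne
    · rw [he]; simp [mass]
    · obtain ⟨g, hg, hmax⟩ := Lo.exists_max_image threshold hne
      refine lt_of_le_of_lt (mass_mono (fun h hh => ?_) fun h hh => hl h (Finset.mem_filter.1 hh).1)
        (Finset.mem_filter.1 hg).2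
      exact Finset.mem_filter.2 ⟨(Finset.mem_filter.1 hh).1, hmax h hh⟩
  have mHi : mass l Hi ≤ 1 / 10 := by
    rcases Hi.eq_empty_or_nonempty with he | hne
    · rw [he]; simp [mass]
    · obtain ⟨g, hg, hmin⟩ := Hi.exists_min_image threshold hne
      have h1 : mass l Hi ≤ mass l (P.filter fun h => ¬ threshold h < threshold g) :=
        mass_mono (fun h hh => Finset.mem_filter.2 ⟨(Finset.mem_filter.1 hh).1,
          not_lt.2 (hmin h hh)⟩) fun h hh => hl h (Finset.mem_filter.1 hh).1
      have h2 := mass_filter_add_mass_filter_not l P fun h => threshold h < threshold g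
      have h3 : 9 / 10 ≤ mass l (P.filter fun h => threshold h < threshold g) :=
        (Finset.mem_filter.1 hg).2
      linarith
  set Q := P \ (Lo ∪ Hi) with hQ
  have hsub : Lo ∪ Hi ⊆ P := Finset.union_subset (Finset.filter_subset _ _)
    (Finset.filter_subset _ _)
  have mQ : 4 / 5 < mass l Q := by
    have h1 := mass_sdiff_add l hsub
    have h2 : mass l (Lo ∪ Hi) ≤ mass l Lo + mass l Hi := mass_union_le fun h hh => hl h (hsub hh)
    rw [hQ]; linarith
  have hQmem : ∀ h ∈ Q, h ∈ P ∧ 1 / 10 ≤ F (threshold h) ∧ F' (threshold h) < 9 / 10 := by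
    intro h hh
    simp only [hQ, hLo, hHi, Finset.mem_sdiff, Finset.mem_union, Finset.mem_filter, not_or,
      not_and, not_lt, not_le] at hh
    exact ⟨hh.1, hh.2.1 hh.1, hh.2.2 hh.1⟩
  have hdistQ : ∀ h ∈ Q, ∀ g ∈ Q, threshold h ≤ threshold g →
      hdist D h g ≤ D.real {x | 1 / 10 ≤ uncertainty P l x} := by
    intro h hh g hg hle
    obtain ⟨hhP, hh1, _⟩ := hQmem h hh
    obtain ⟨hgP, _, hg2⟩ := hQmem g hg
    rw [hdist, thresholds_ne_set (hP h hhP) (hP g hgP) hle]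
    refine measureReal_mono fun x hx => ?_
    have h1 : F (threshold h) ≤ F x := mass_mono (fun f hf => Finset.mem_filter.2
      ⟨(Finset.mem_filter.1 hf).1, (Finset.mem_filter.1 hf).2.trans hx.1⟩)
      fun f hf => hl f (Finset.mem_filter.1 hf).1
    have h2 : F x ≤ F' (threshold g) := mass_mono (fun f hf => Finset.mem_filter.2
      ⟨(Finset.mem_filter.1 hf).1, (Finset.mem_filter.1 hf).2.trans_lt hx.2⟩)
      fun f hf => hl f (Finset.mem_filter.1 hf).1
    rw [Set.mem_ofPred_eq, hunc, le_min_iff]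
    constructor <;> linarith
  -- Between two members of the middle part `Q` every point has uncertainty at least `1/10`. If
  -- those points had probability at most `R`, then `Q`, of mass above `4/5`, would fit in the
  -- `R`-ball around any of its members.
  by_contra! hc
  apply hR
  obtain ⟨μ, hμ⟩ : Q.Nonempty := by
    rw [Finset.nonempty_iff_ne_empty]
    intro he
    rw [he] at mQ
    simp only [mass, Finset.sum_empty] at mQ
    linarith
  refine ⟨μ, (hQmem μ hμ).1, mQ.trans_le (mass_mono (fun h hh => ?_) fun h hh =>
    hl h (Finset.mem_filter.1 hh).1)⟩
  refine Finset.mem_filter.2 ⟨(hQmem h hh).1, le_trans ?_ hc⟩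
  rcases le_total (threshold μ) (threshold h) with hle | hle
  · exact hdistQ μ hμ h hh hle
  · rw [hdist_comm]; exact hdistQ h hh μ hμ hle

/-- If no ball of radius `R` is heavy, then every optimal query distribution has a large
objective. -/
theorem le_objective_of_not_hasHeavyBall [IsProbabilityMeasure D] {P : Finset (Hyp ℝ)}
    (hP : ∀ h ∈ P, h ∈ thresholds T) {l : Hyp ℝ → ℝ} (hl : ∀ h ∈ P, 0 ≤ l h)
    (hl1 : mass l P = 1) {R c : ℝ} (hc : 0 < c) (hcR : 20 * c ≤ R)
    (hR : ¬ HasHeavyBall D P l R) {q : Measure ℝ}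
    (hq : IsOptimalQuery D (uncertainty P l) c q) :
    1 / 20 ≤ objective D (uncertainty P l) c q := by
  have hm := fun h hh => measurable_of_mem_thresholds (hP h hh)
  set A := {x | 1 / 10 ≤ uncertainty P l x} with hA
  have hAm : MeasurableSet A := measurableSet_le measurable_const (measurable_uncertainty hm l)
  have hDA : R < D.real A := lt_measureReal_uncertain hP hl hl1 hR
  have hRpos : 0 < R := by linarith
  have hDA0 : D A ≠ 0 := fun h0 => by
    rw [measureReal_def, h0] at hDA
    simp only [ENNReal.toReal_zero] at hDA
    linarith
  have hprob : IsProbabilityMeasure (ProbabilityTheory.cond D A) := cond_isProbabilityMeasure hDA0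
  have hratio : maxRatio (ProbabilityTheory.cond D A) D ≤ (D A)⁻¹ := maxRatio_le (cond_le_smul A)
  have hinv : (D A)⁻¹ ≠ ⊤ := ENNReal.inv_ne_top.2 hDA0
  refine le_trans ?_ (hq.2.2 _ hprob (ne_top_of_le_ne_top hinv hratio))
  have h1 : (maxRatio (ProbabilityTheory.cond D A) D).toReal ≤ 1 / R := by
    refine (ENNReal.toReal_mono hinv hratio).trans ?_
    rw [ENNReal.toReal_inv, ← measureReal_def, one_div]
    exact inv_anti₀ hRpos hDA.le
  have h2 : 1 / 10 ≤ ∫ x, uncertainty P l x ∂(ProbabilityTheory.cond D A) := by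
    calc (1 / 10 : ℝ) = ∫ _x, (1 / 10 : ℝ) ∂(ProbabilityTheory.cond D A) := by simp
      _ ≤ _ := by
        refine integral_mono_ae (integrable_const _) (integrable_uncertainty hm l _) ?_
        exact ae_cond_mem hAm
  have h3 : c * (maxRatio (ProbabilityTheory.cond D A) D).toReal ≤ 1 / 20 := by
    calc c * (maxRatio (ProbabilityTheory.cond D A) D).toReal ≤ c * (1 / R) :=
          mul_le_mul_of_nonneg_left h1 hc.le
      _ ≤ 1 / 20 := by
        rw [mul_one_div, div_le_iff₀ hRpos]; linarith
  simp only [objective]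
  linarith

end Thresholds

/-! ### The capped distribution -/

section Capped

variable {X : Type} {l : Hyp X → ℝ}

/-- The capped distribution is the average of `l` and of `l` conditioned on the complement
of `S`. -/
theorem mass_capped {S : Finset (Hyp X)} (hS : mass l S < 1) (Q : Finset (Hyp X)) :
    mass (capped l S) Q = 1 / 2 * mass l Q + 1 / 2 * (mass l (Q \ S) / (1 - mass l S)) := by
  have h0 : 1 - mass l S ≠ 0 := by linarith
  have e : mass l (Q \ S) = ∑ h ∈ Q, if h ∈ S then 0 else l h := by
    rw [mass, Finset.sdiff_eq_filter, Finset.sum_filter]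
    exact Finset.sum_congr rfl fun h _ => by by_cases hh : h ∈ S <;> simp [hh]
  rw [e, Finset.sum_div, Finset.mul_sum, mass, mass, Finset.mul_sum, ← Finset.sum_add_distrib]
  refine Finset.sum_congr rfl fun h _ => ?_
  rw [capped]
  split_ifs
  · ring
  · field_simp; ring

theorem capped_nonneg {S : Finset (Hyp X)} (hS : mass l S < 1) {h : Hyp X} (hl : 0 ≤ l h) :
    0 ≤ capped l S h := by
  rw [capped]
  split_ifs
  · positivity
  · exact mul_nonneg hl (div_nonneg (by linarith) (by linarith))

theorem mass_sdiff_div_le_one {P S Q : Finset (Hyp X)} (hl : ∀ h ∈ P, 0 ≤ l h)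
    (hl1 : mass l P = 1) (hSP : S ⊆ P) (hS : mass l S < 1) (hQP : Q ⊆ P) :
    mass l (Q \ S) / (1 - mass l S) ≤ 1 := by
  rw [div_le_one (by linarith)]
  have h1 := mass_sdiff_add l hSP
  have h2 : mass l (Q \ S) ≤ mass l (P \ S) := mass_mono (Finset.sdiff_subset_sdiff hQP le_rfl)
    fun h hh => hl h (Finset.mem_sdiff.1 hh).1
  linarith

theorem mass_capped_univ {P S : Finset (Hyp X)} (hl1 : mass l P = 1) (hSP : S ⊆ P)
    (hS : mass l S < 1) : mass (capped l S) P = 1 := by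
  have h1 := mass_sdiff_add l hSP
  have h2 : mass l (P \ S) = 1 - mass l S := by linarith
  rw [mass_capped hS, hl1, h2, div_self (by linarith)]
  norm_num

/-- Whatever the label, the hypotheses that are wrong on it have mass at least the uncertainty. -/
theorem uncertainty_le_mass_wrong {P : Finset (Hyp X)} (hl1 : mass l P = 1) (x : X) (y : Bool) :
    uncertainty P l x ≤ mass l (P.filter fun h => h x ≠ y) := by
  have h1 := mass_filter_add_mass_filter_not l P fun h => h x = true
  cases y with
  | true =>
    refine (min_le_right _ _).trans_eq ?_
    rw [← hl1, ← h1]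
    simp
  | false =>
    refine (min_le_left _ _).trans_eq ?_
    simp

theorem uncertainty_nonneg {P : Finset (Hyp X)} (hl : ∀ h ∈ P, 0 ≤ l h) (hl1 : mass l P = 1)
    (x : X) : 0 ≤ uncertainty P l x := by
  refine le_min (mass_nonneg fun h hh => hl h (Finset.mem_filter.1 hh).1) (sub_nonneg.2 ?_)
  rw [← hl1]
  exact mass_mono (Finset.filter_subset _ _) hl

theorem uncertainty_le_one {P : Finset (Hyp X)} (hl : ∀ h ∈ P, 0 ≤ l h) (hl1 : mass l P = 1)
    (x : X) : uncertainty P l x ≤ 1 := by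
  refine (min_le_left _ _).trans ?_
  rw [← hl1]
  exact mass_mono (Finset.filter_subset _ _) hl

theorem normalize_nonneg {P : Finset (Hyp X)} {w : Hyp X → ℝ} (hw : ∀ h ∈ P, 0 < w h) {h : Hyp X}
    (hh : h ∈ P) : 0 ≤ normalize P w h :=
  div_nonneg (hw h hh).le (mass_nonneg fun g hg => (hw g hg).le)

theorem mass_normalize (P : Finset (Hyp X)) (w : Hyp X → ℝ) (Q : Finset (Hyp X)) :
    mass (normalize P w) Q = mass w Q / mass w P := by
  simp only [mass, normalize, Finset.sum_div]

theorem mass_pos {P : Finset (Hyp X)} {w : Hyp X → ℝ} (hw : ∀ h ∈ P, 0 < w h) {g : Hyp X}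
    (hg : g ∈ P) : 0 < mass w P :=
  Finset.sum_pos hw ⟨g, hg⟩

theorem mass_normalize_self {P : Finset (Hyp X)} {w : Hyp X → ℝ} (hw : ∀ h ∈ P, 0 < w h)
    {g : Hyp X} (hg : g ∈ P) : mass (normalize P w) P = 1 := by
  rw [mass_normalize, div_self (mass_pos hw hg).ne']

theorem mass_normalize_lt_one {P S : Finset (Hyp X)} {w : Hyp X → ℝ} (hw : ∀ h ∈ P, 0 < w h)
    {g : Hyp X} (hg : g ∈ P) (hgS : g ∉ S) (hSP : S ⊆ P) : mass (normalize P w) S < 1 := by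
  rw [mass_normalize, div_lt_one (mass_pos hw hg), ← mass_sdiff_add w hSP]
  have : 0 < mass w (P \ S) := mass_pos (fun h hh => hw h (Finset.mem_sdiff.1 hh).1)
    (Finset.mem_sdiff.2 ⟨hg, hgS⟩)
  linarith

/-- Capping the neighbourhood of the heaviest ball leaves no heavy ball. -/
theorem not_hasHeavyBall_capped_union [MeasurableSpace X] {D : Measure X} [IsFiniteMeasure D]
    {P S : Finset (Hyp X)}
    (hl : ∀ h ∈ P, 0 ≤ l h) (hl1 : mass l P = 1) (hSP : S ⊆ P) {R : ℝ} {μ : Hyp X}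
    (hμ : IsHeaviestCenter D P l R μ) (hS' : mass l (S ∪ ball D P μ (3 * R)) < 1)
    (hheavy : HasHeavyBall D P (capped l S) R) :
    ¬ HasHeavyBall D P (capped l (S ∪ ball D P μ (3 * R))) R := by
  have hball : ∀ ν r, ball D P ν r ⊆ P := fun ν r => Finset.filter_subset _ _
  have hS'P : S ∪ ball D P μ (3 * R) ⊆ P := Finset.union_subset hSP (hball _ _)
  have hS : mass l S < 1 :=
    (mass_mono Finset.subset_union_left fun h hh => hl h (hS'P hh)).trans_lt hS'
  -- The conditioned half contributes at most `1/2` to a capped mass above `4/5`, so `λ` itself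
  -- gives that ball, and hence the heaviest one, more than `3/5`.
  have hμmass : 3 / 5 < mass l (ball D P μ R) := by
    obtain ⟨ν, hν, hν'⟩ := hheavy
    rw [mass_capped hS] at hν'
    have := mass_sdiff_div_le_one hl hl1 hSP hS (hball ν R)
    have := hμ.2 ν hν
    linarith
  rintro ⟨ν, hν, hν'⟩
  rw [mass_capped hS'] at hν'
  -- A ball disjoint from the heaviest has `λ`-mass below `2/5`, hence capped mass below `7/10`. A
  -- ball meeting it lies in the `3R`-ball, where capping leaves at most `1/2`.
  by_cases hdisj : Disjoint (ball D P ν R) (ball D P μ R)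
  · have h1 : mass l (ball D P ν R) + mass l (ball D P μ R) ≤ 1 := by
      rw [← hl1, mass, mass, ← Finset.sum_union hdisj]
      exact mass_mono (Finset.union_subset (hball _ _) (hball _ _)) hl
    have := mass_sdiff_div_le_one hl hl1 hS'P hS' (hball ν R)
    linarith
  · obtain ⟨g, hgν, hgμ⟩ := Finset.not_disjoint_iff.1 hdisj
    have hsub : ball D P ν R ⊆ S ∪ ball D P μ (3 * R) := by
      intro f hf
      refine Finset.mem_union_right _ (Finset.mem_filter.2 ⟨hball _ _ hf, ?_⟩)
      have h1 : hdist D μ g ≤ R := (Finset.mem_filter.1 hgμ).2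
      have h2 : hdist D ν g ≤ R := (Finset.mem_filter.1 hgν).2
      have h3 : hdist D ν f ≤ R := (Finset.mem_filter.1 hf).2
      have h4 := hdist_triangle (D := D) μ g f
      have h5 := hdist_triangle (D := D) g ν f
      rw [hdist_comm g ν] at h5
      linarith
    rw [Finset.sdiff_eq_empty_iff_subset.2 hsub] at hν'
    have h1 : mass l (ball D P ν R) ≤ 1 := hl1 ▸ mass_mono (hball ν R) hl
    simp only [mass, Finset.sum_empty, zero_div] at hν' h1
    linarith

end Capped

/-! ### The potential of the first stage -/

section Potential

variable {X : Type}

/-- The inverse square root of the product of the weight of `g` relative to `P` and its weight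
relative to `P \ S`. -/
def potential (P : Finset (Hyp X)) (g : Hyp X) (w : Hyp X → ℝ) (S : Finset (Hyp X)) : ℝ :=
  Real.sqrt (mass w P * mass w (P \ S)) / w g

/-- An uncovered `g` contributes its own weight to both masses under the root. -/
theorem one_le_potential {P S : Finset (Hyp X)} {w : Hyp X → ℝ} (hw : ∀ h ∈ P, 0 < w h)
    {g : Hyp X} (hg : g ∈ P) (hgS : g ∉ S) : 1 ≤ potential P g w S := by
  have hw' : ∀ h ∈ P \ S, 0 ≤ w h := fun h hh => (hw h (Finset.mem_sdiff.1 hh).1).le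
  rw [potential, one_le_div (hw g hg)]
  refine Real.le_sqrt_of_sq_le ?_
  rw [sq]
  have h1 : w g ≤ mass w P := Finset.single_le_sum (fun h hh => (hw h hh).le) hg
  have h2 : w g ≤ mass w (P \ S) :=
    Finset.single_le_sum hw' (Finset.mem_sdiff.2 ⟨hg, hgS⟩)
  exact mul_le_mul h1 h2 (hw g hg).le ((hw g hg).le.trans h1)

theorem potential_nonneg {P S : Finset (Hyp X)} {w : Hyp X → ℝ} (hw : ∀ h ∈ P, 0 < w h)
    {g : Hyp X} (hg : g ∈ P) : 0 ≤ potential P g w S :=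
  div_nonneg (Real.sqrt_nonneg _) (hw g hg).le

theorem potential_anti {P S S' : Finset (Hyp X)} {w : Hyp X → ℝ} (hw : ∀ h ∈ P, 0 < w h)
    {g : Hyp X} (hg : g ∈ P) (hSS' : S ⊆ S') : potential P g w S' ≤ potential P g w S := by
  refine div_le_div_of_nonneg_right (Real.sqrt_le_sqrt ?_) (hw g hg).le
  refine mul_le_mul_of_nonneg_left ?_ (mass_nonneg fun h hh => (hw h hh).le)
  exact mass_mono (Finset.sdiff_subset_sdiff le_rfl hSS') fun h hh =>
    (hw h (Finset.mem_sdiff.1 hh).1).le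

theorem potential_const {P : Finset (Hyp X)} {g : Hyp X} :
    potential P g (fun _ => 1) ∅ = P.card := by
  simp [potential, mass]

theorem mass_reweight {P A : Finset (Hyp X)} (hA : A ⊆ P) (w : Hyp X → ℝ) (x : X) (y : Bool) :
    mass (reweight P w x y) A =
      mass w A - (1 - Real.exp (-α)) * mass w (A.filter fun h => h x ≠ y) := by
  simp only [mass]
  rw [Finset.sum_filter, Finset.mul_sum, ← Finset.sum_sub_distrib]
  refine Finset.sum_congr rfl fun h hh => ?_
  by_cases hy : h x ≠ y
  · rw [reweight, if_pos ⟨hA hh, hy⟩, if_pos hy]; ring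
  · rw [reweight, if_neg fun hc => hy hc.2, if_neg hy]; ring

theorem reweight_pos {P : Finset (Hyp X)} {w : Hyp X → ℝ} {x : X} {y : Bool} {h : Hyp X}
    (hw : 0 < w h) : 0 < reweight P w x y h := by
  rw [reweight]
  split_ifs
  · exact mul_pos (Real.exp_pos _) hw
  · exact hw

theorem exp_neg_α_le : Real.exp (-α) ≤ 5 / 6 := by
  have h1 := Real.add_one_le_exp α
  rw [Real.exp_neg, inv_le_comm₀ (Real.exp_pos _) (by norm_num)]
  rw [α] at *
  norm_num at *
  linarith

theorem exp_α_le : Real.exp α ≤ 5 / 4 := by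
  have h1 := Real.add_one_le_exp (-α)
  rw [Real.exp_neg] at h1
  have h2 : (4 / 5 : ℝ) ≤ (Real.exp α)⁻¹ := by rw [α] at *; linarith
  rw [le_inv_comm₀ (by norm_num) (Real.exp_pos _)] at h2
  norm_num at h2 ⊢
  exact h2

/-- The effect of one label on the potential. -/
theorem potential_reweight_le {P S : Finset (Hyp X)} {w : Hyp X → ℝ} (hw : ∀ h ∈ P, 0 < w h)
    (hSP : S ⊆ P) {g : Hyp X} (hg : g ∈ P) (hgS : g ∉ S) (x : X) (y : Bool) :
    potential P g (reweight P w x y) S ≤ potential P g w S *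
      (1 - 1 / 6 * uncertainty P (capped (normalize P w) S) x + if g x ≠ y then 1 / 4 else 0) := by
  set l := normalize P w with hl
  set r := uncertainty P (capped l S) x with hr
  set β := 1 - Real.exp (-α) with hβ
  have hβ6 : 1 / 6 ≤ β := by have := exp_neg_α_le; rw [hβ]; linarith
  have hβ1 : β ≤ 1 := by have := Real.exp_pos (-α); rw [hβ]; linarith
  have hw' : ∀ h ∈ P \ S, 0 < w h := fun h hh => hw h (Finset.mem_sdiff.1 hh).1
  have hl0 : ∀ h ∈ P, 0 ≤ l h := fun h hh => normalize_nonneg hw hh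
  have hl1 : mass l P = 1 := mass_normalize_self hw hg
  have hlS : mass l S < 1 := mass_normalize_lt_one hw hg hgS hSP
  set W := mass w P with hW
  set W' := mass w (P \ S) with hW'
  have hWpos : 0 < W := mass_pos hw hg
  have hW'pos : 0 < W' := mass_pos hw' (Finset.mem_sdiff.2 ⟨hg, hgS⟩)
  set a := mass w (P.filter fun h => h x ≠ y) / W with ha
  set b := mass w ((P \ S).filter fun h => h x ≠ y) / W' with hb
  have ha1 : a ≤ 1 := by
    rw [ha, div_le_one hWpos]
    exact mass_mono (Finset.filter_subset _ _) fun h hh => (hw h hh).le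
  have hb1 : b ≤ 1 := by
    rw [hb, div_le_one hW'pos]
    exact mass_mono (Finset.filter_subset _ _) fun h hh => (hw' h hh).le
  have hcap : r ≤ (a + b) / 2 := by
    refine (uncertainty_le_mass_wrong (mass_capped_univ hl1 hSP hlS) x y).trans_eq ?_
    rw [mass_capped hlS, hl, mass_normalize, mass_normalize, mass_normalize]
    have h1 : (P.filter fun h => h x ≠ y) \ S = (P \ S).filter fun h => h x ≠ y := by
      ext h; simp only [Finset.mem_sdiff, Finset.mem_filter]; tauto
    have h2 : 1 - mass w S / W = W' / W := by
      have := mass_sdiff_add w hSP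
      rw [eq_div_iff hWpos.ne', sub_mul, div_mul_cancel₀ _ hWpos.ne']
      linarith
    rw [h1, h2, div_div_div_cancel_right₀ hWpos.ne']
    ring
  have hr0 : 0 ≤ r := uncertainty_nonneg (fun h hh => capped_nonneg hlS (hl0 h hh))
    (mass_capped_univ hl1 hSP hlS) x
  have e1 : mass (reweight P w x y) P = W * (1 - β * a) := by
    rw [mass_reweight le_rfl, ha, ← hβ, ← hW]; field_simp
  have e2 : mass (reweight P w x y) (P \ S) = W' * (1 - β * b) := by
    rw [mass_reweight Finset.sdiff_subset, hb, ← hβ, ← hW']; field_simp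
  have hβa : 0 ≤ 1 - β * a := by nlinarith
  have hβb : 0 ≤ 1 - β * b := by nlinarith
  -- AM-GM: the geometric mean of the two shrinking factors is at most their arithmetic mean, which
  -- the capped mass of the wrong hypotheses controls.
  have hsqrt : Real.sqrt ((1 - β * a) * (1 - β * b)) ≤ 1 - 1 / 6 * r := by
    refine (Real.sqrt_le_sqrt (y := (1 - β * ((a + b) / 2)) ^ 2) ?_).trans ?_
    · nlinarith [sq_nonneg (β * a - β * b)]
    · rw [Real.sqrt_sq (by linarith)]
      have : 1 / 6 * r ≤ β * ((a + b) / 2) := mul_le_mul hβ6 hcap hr0 (by linarith)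
      linarith
  have hnum : Real.sqrt (mass (reweight P w x y) P * mass (reweight P w x y) (P \ S)) ≤
      Real.sqrt (W * W') * (1 - 1 / 6 * r) := by
    rw [e1, e2, show W * (1 - β * a) * (W' * (1 - β * b)) =
      (W * W') * ((1 - β * a) * (1 - β * b)) by ring, Real.sqrt_mul (by positivity)]
    exact mul_le_mul_of_nonneg_left hsqrt (Real.sqrt_nonneg _)
  have hwg := hw g hg
  have hr1 : 0 ≤ 1 - 1 / 6 * r := (Real.sqrt_nonneg _).trans hsqrt
  simp only [potential]
  by_cases hy : g x ≠ y
  · rw [reweight, if_pos ⟨hg, hy⟩, if_pos hy]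
    calc _ ≤ Real.sqrt (W * W') * (1 - 1 / 6 * r) / (Real.exp (-α) * w g) :=
          div_le_div_of_nonneg_right hnum (mul_pos (Real.exp_pos _) hwg).le
      _ = Real.sqrt (W * W') / w g * (Real.exp α * (1 - 1 / 6 * r)) := by
          rw [Real.exp_neg]; field_simp
      _ ≤ _ := by
          refine mul_le_mul_of_nonneg_left ?_ (div_nonneg (Real.sqrt_nonneg _) hwg.le)
          have := mul_le_mul_of_nonneg_right exp_α_le hr1
          linarith
  · rw [reweight, if_neg fun hc => hy hc.2, if_neg hy, add_zero]
    calc _ ≤ Real.sqrt (W * W') * (1 - 1 / 6 * r) / w g :=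
          div_le_div_of_nonneg_right hnum hwg.le
      _ = _ := by ring

end Potential

/-! ### The first stage -/

section StageOne

/-- In expectation, a query with a large objective decreases the potential by a constant factor. -/
theorem lintegral_update_le {X : Type} [MeasurableSpace X] {D : Measure X}
    [IsProbabilityMeasure D] {κ : Kernel X Bool} [IsMarkovKernel κ] {q : Measure X}
    [IsProbabilityMeasure q] (hfin : maxRatio q D ≠ ⊤) {g : Hyp X} (hg : Measurable g) {r : X → ℝ}
    (hr : Measurable r) (hr0 : ∀ x, 0 ≤ r x) (hr1 : ∀ x, r x ≤ 1) {c : ℝ}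
    (hc : 5 * err (D ⊗ₘ κ) g ≤ c) (hobj : 1 / 20 ≤ objective D r c q) :
    ∫⁻ x, ∫⁻ y, ENNReal.ofReal (1 - 1 / 6 * r x + if g x ≠ y then 1 / 4 else 0) ∂(κ x) ∂q ≤
      ENNReal.ofReal (119 / 120) := by
  have hint : Integrable r q := Integrable.of_bound hr.aestronglyMeasurable 1
    (ae_of_all _ fun x => by rw [Real.norm_eq_abs, abs_of_nonneg (hr0 x)]; exact hr1 x)
  have inner : ∀ x, ∫⁻ y, ENNReal.ofReal (1 - 1 / 6 * r x + if g x ≠ y then 1 / 4 else 0) ∂(κ x) =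
      ENNReal.ofReal (1 - 1 / 6 * r x) + ENNReal.ofReal (1 / 4) * κ x {y | g x ≠ y} := by
    intro x
    have h1 : ∀ y, ENNReal.ofReal (1 - 1 / 6 * r x + if g x ≠ y then 1 / 4 else 0) =
        ENNReal.ofReal (1 - 1 / 6 * r x) +
          Set.indicator {y | g x ≠ y} (fun _ => ENNReal.ofReal (1 / 4)) y := by
      intro y
      rw [ENNReal.ofReal_add (by linarith [hr1 x]) (by split_ifs <;> norm_num)]
      by_cases hy : g x ≠ y
      · rw [if_pos hy, Set.indicator_of_mem (show y ∈ {y | g x ≠ y} from hy)]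
      · rw [if_neg hy, Set.indicator_of_notMem (show y ∉ {y | g x ≠ y} from hy),
          ENNReal.ofReal_zero]
    rw [lintegral_congr h1, lintegral_add_left measurable_const,
      lintegral_indicator_const MeasurableSet.of_discrete, lintegral_const, measure_univ, mul_one]
  have hmeas : Measurable fun x => ENNReal.ofReal (1 - 1 / 6 * r x) :=
    ENNReal.measurable_ofReal.comp ((hr.const_mul _).const_sub _)
  have hint' : Integrable (fun x => 1 - 1 / 6 * r x) q :=
    (integrable_const _).sub (hint.const_mul _)
  rw [lintegral_congr inner, lintegral_add_left hmeas,
    lintegral_const_mul' _ _ ENNReal.ofReal_ne_top,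
    ← ofReal_integral_eq_lintegral_ofReal hint'
      (ae_of_all _ fun x => by simp only [Pi.zero_apply]; linarith [hr1 x])]
  have hwrong := lintegral_wrong_le (κ := κ) (le_maxRatio_smul hfin) hg
  have hM : maxRatio q D = ENNReal.ofReal (maxRatio q D).toReal := (ENNReal.ofReal_toReal hfin).symm
  set M := (maxRatio q D).toReal with hMdef
  have hM0 : 0 ≤ M := ENNReal.toReal_nonneg
  have herr0 : 0 ≤ err (D ⊗ₘ κ) g := measureReal_nonneg
  have hI : ∫ x, (1 - 1 / 6 * r x) ∂q = 1 - 1 / 6 * ∫ x, r x ∂q := by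
    rw [integral_sub (integrable_const _) (hint.const_mul _), integral_const_mul]
    simp
  have hI1 : ∫ x, r x ∂q ≤ 1 := by
    calc ∫ x, r x ∂q ≤ ∫ _x, (1 : ℝ) ∂q := integral_mono hint (integrable_const _) hr1
      _ = 1 := by simp
  rw [hM, ← ENNReal.ofReal_mul hM0] at hwrong
  calc _ ≤ ENNReal.ofReal (∫ x, (1 - 1 / 6 * r x) ∂q) +
        ENNReal.ofReal (1 / 4) * ENNReal.ofReal (M * err (D ⊗ₘ κ) g) := by gcongr
    _ = ENNReal.ofReal (1 - 1 / 6 * ∫ x, r x ∂q + 1 / 4 * (M * err (D ⊗ₘ κ) g)) := by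
        rw [hI, ← ENNReal.ofReal_mul (by norm_num), ← ENNReal.ofReal_add (by linarith)
          (by positivity)]
    _ ≤ ENNReal.ofReal (119 / 120) := by
        refine ENNReal.ofReal_le_ofReal ?_
        simp only [objective, ← hMdef] at hobj
        -- Since the error of `g` is at most `c/5`, its cost `M * err / 4` is at most `c * M / 20`,
        -- less than a sixth of the penalty `c * M`. The factor is thus at most `1 - 1/6 * 1/20 =
        -- 119/120`.
        have h1 := mul_le_mul_of_nonneg_right hc hM0
        have h2 : 0 ≤ M * err (D ⊗ₘ κ) g := by positivity
        nlinarith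

variable {X : Type} [MeasurableSpace X] {D : Measure X} {H : Set (Hyp X)} {c₄ c₅ η ε : ℝ}

/-- What the states of the first stage have in common. -/
structure State.Valid (ch : Choices D H c₄ c₅ η ε) (s : State X) : Prop where
  w_pos : ∀ h ∈ ch.pack, 0 < s.w h
  S_subset : s.S ⊆ ch.pack
  C_subset : s.C ⊆ ch.pack
  cover : ∀ h ∈ s.S, ∃ μ ∈ s.C, hdist D μ h ≤ 3 * radius c₄ c₅ η ε

theorem expand_w (ch : Choices D H c₄ c₅ η ε) (s : State X) : (expand ch s).w = s.w := by
  rw [expand]; split_ifs <;> rfl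

theorem subset_expand_S (ch : Choices D H c₄ c₅ η ε) (s : State X) : s.S ⊆ (expand ch s).S := by
  rw [expand]
  split_ifs
  · exact Finset.subset_union_left
  · exact le_rfl

theorem card_expand_C_le (ch : Choices D H c₄ c₅ η ε) (s : State X) :
    (expand ch s).C.card ≤ s.C.card + 1 := by
  rw [expand]
  split_ifs
  · exact Finset.card_insert_le _ _
  · exact Nat.le_succ _

theorem State.Valid.expand {ch : Choices D H c₄ c₅ η ε} {s : State X} (hs : s.Valid ch) :
    (expand ch s).Valid ch := by
  rw [ActiveLearning.expand]
  split_ifs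
  · refine ⟨hs.w_pos, Finset.union_subset hs.S_subset (Finset.filter_subset _ _),
      Finset.insert_subset (ch.center_spec _).1 hs.C_subset, fun h hh => ?_⟩
    rcases Finset.mem_union.1 hh with hh | hh
    · obtain ⟨μ, hμ, hd⟩ := hs.cover h hh
      exact ⟨μ, Finset.mem_insert_of_mem hμ, hd⟩
    · exact ⟨_, Finset.mem_insert_self _ _, (Finset.mem_filter.1 hh).2⟩
  · exact hs

theorem State.Valid.reweight {ch : Choices D H c₄ c₅ η ε} {s : State X} (hs : s.Valid ch) (x : X)
    (y : Bool) : State.Valid ch ⟨reweight ch.pack s.w x y, s.S, s.C⟩ :=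
  ⟨fun h hh => reweight_pos (hs.w_pos h hh), hs.S_subset, hs.C_subset, hs.cover⟩

/-- After the expansion step the capped distribution has no heavy ball. -/
theorem not_hasHeavyBall_expand [IsFiniteMeasure D] {ch : Choices D H c₄ c₅ η ε} {s : State X}
    (hs : s.Valid ch) {g : Hyp X} (hg : g ∈ ch.pack) (hgS : g ∉ (expand ch s).S) :
    ¬ HasHeavyBall D ch.pack (capped (normalize ch.pack (expand ch s).w) (expand ch s).S)
      (radius c₄ c₅ η ε) := by
  have hlt := mass_normalize_lt_one hs.expand.w_pos hg hgS hs.expand.S_subset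
  by_cases hh : HasHeavyBall D ch.pack (capped (normalize ch.pack s.w) s.S) (radius c₄ c₅ η ε)
  · rw [expand, if_pos hh] at hlt ⊢
    exact not_hasHeavyBall_capped_union (fun h hP => normalize_nonneg hs.w_pos hP)
      (mass_normalize_self hs.w_pos hg) hs.S_subset (ch.center_spec _) hlt hh
  · rw [expand, if_neg hh]
    exact hh

/-- The potential of the hypothesis `g`, counted as zero once `g` is covered. -/
def statePotential (P : Finset (Hyp X)) (g : Hyp X) (s : State X) : ℝ≥0∞ :=
  if g ∈ s.S then 0 else ENNReal.ofReal (potential P g s.w s.S)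

theorem statePotential_expand_le {ch : Choices D H c₄ c₅ η ε} {s : State X} (hs : s.Valid ch)
    {g : Hyp X} (hg : g ∈ ch.pack) :
    statePotential ch.pack g (expand ch s) ≤ statePotential ch.pack g s := by
  rw [statePotential, statePotential]
  split_ifs with h1 h2 h2
  · exact le_rfl
  · exact zero_le
  · exact absurd (subset_expand_S ch s h2) h1
  · rw [expand_w]
    exact ENNReal.ofReal_le_ofReal (potential_anti hs.w_pos hg (subset_expand_S ch s))

end StageOne

section StageOneThresholds

variable {D : Measure ℝ} {T : Set ℝ} {c₄ c₅ η ε : ℝ} {Out : Type}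

/-- The first stage covers the hypothesis `g` except with probability exponentially small in the
number of rounds. -/
theorem one_le_successProb_stage₁ [IsProbabilityMeasure D] {κ : Kernel ℝ Bool} [IsMarkovKernel κ]
    (ch : Choices D (thresholds T) c₄ c₅ η ε) (hη : 0 < η) (hε : 0 ≤ ε) (hc₄ : 0 < c₄)
    (hc₅ : 0 ≤ c₅) {g : Hyp ℝ} (hg : g ∈ ch.pack) (herr : 5 * err (D ⊗ₘ κ) g ≤ c₄ / 20 * η)
    {good : Set Out} (f : State ℝ → Prog ℝ Out) (k m : ℕ) (B : ℝ≥0∞)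
    (hf : ∀ s, s.Valid ch → g ∈ s.S → s.C.card ≤ k → 1 ≤ (f s).successProb κ good m + B) :
    ∀ (n : ℕ) (s : State ℝ), s.Valid ch → s.C.card + n ≤ k →
      1 ≤ ((stage₁ ch n s).bind f).successProb κ good (n + m) +
        (ENNReal.ofReal (119 / 120) ^ n * statePotential ch.pack g s + B)
  | 0, s, hs, hk => by
    simp only [stage₁, Prog.bind, zero_add, pow_zero, one_mul]
    by_cases hgS : g ∈ s.S
    · rw [statePotential, if_pos hgS, zero_add]
      exact hf s hs hgS hk
    · rw [statePotential, if_neg hgS]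
      have : (1 : ℝ≥0∞) ≤ ENNReal.ofReal (potential ch.pack g s.w s.S) :=
        ENNReal.one_le_ofReal.2 (one_le_potential hs.w_pos hg hgS)
      exact this.trans (le_self_add.trans le_add_self)
  | n + 1, s, hs, hk => by
    have hP : ∀ h ∈ ch.pack, h ∈ thresholds T := ch.pack_spec.1.1
    have hPm : ∀ h ∈ ch.pack, Measurable h := fun h hh => measurable_of_mem_thresholds (hP h hh)
    set s' := expand ch s with hs'def
    have hs' : s'.Valid ch := hs.expand
    set l := capped (normalize ch.pack s'.w) s'.S with hl
    have hopt := ch.queryDist_spec l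
    have hprob : IsProbabilityMeasure (ch.queryDist l) := hopt.1
    have ih := fun x y => one_le_successProb_stage₁ ch hη hε hc₄ hc₅ hg herr f k m B hf n
      ⟨reweight ch.pack s'.w x y, s'.S, s'.C⟩ (hs'.reweight x y)
      (by have := card_expand_C_le ch s; rw [← hs'def] at this; simp only; omega)
    set ρ := ENNReal.ofReal (119 / 120) with hρ
    set Φ := statePotential ch.pack g s' with hΦ
    set u : ℝ → Bool → ℝ≥0∞ := fun x y =>
      ENNReal.ofReal (1 - 1 / 6 * uncertainty ch.pack l x + if g x ≠ y then 1 / 4 else 0) with hu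
    have hum : Measurable (Function.uncurry u) := by
      refine ENNReal.measurable_ofReal.comp (Measurable.add ?_ ?_)
      · exact (((measurable_uncertainty hPm l).comp measurable_fst).const_mul _).const_sub _
      · exact Measurable.ite (measurableSet_wrong (hPm g hg)) measurable_const measurable_const
    have hstep : ∀ x y, statePotential ch.pack g ⟨reweight ch.pack s'.w x y, s'.S, s'.C⟩ ≤
        Φ * u x y := by
      intro x y
      rw [hΦ, statePotential, statePotential]
      split_ifs with h1
      · exact zero_le
      · rw [hu, ← ENNReal.ofReal_mul (potential_nonneg hs'.w_pos hg)]
        exact ENNReal.ofReal_le_ofReal (potential_reweight_le hs'.w_pos hs'.S_subset hg h1 x y)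
    have hq := Prog.one_le_successProb_query (κ := κ) (good := good) (ch.queryDist l)
      (fun x y => (stage₁ ch n ⟨reweight ch.pack s'.w x y, s'.S, s'.C⟩).bind f) (n + m)
      (fun x y => ρ ^ n * Φ * u x y) (hum.const_mul _) B fun x y => by
        refine (ih x y).trans ?_
        rw [mul_assoc]
        gcongr
        exact hstep x y
    have hΦtop : Φ ≠ ⊤ := by
      rw [hΦ, statePotential]; split_ifs <;> simp
    have hρΦ : ρ ^ n * Φ ≠ ⊤ := ENNReal.mul_ne_top (ENNReal.pow_ne_top ENNReal.ofReal_ne_top) hΦtop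
    have hΦs : Φ ≤ statePotential ch.pack g s := statePotential_expand_le hs hg
    have hfinal : ∫⁻ x, ∫⁻ y, ρ ^ n * Φ * u x y ∂(κ x) ∂(ch.queryDist l) ≤
        ρ ^ (n + 1) * statePotential ch.pack g s := by
      simp only [lintegral_const_mul' _ _ hρΦ]
      -- Once `g` is covered the potential counts as zero and the query costs nothing; only
      -- otherwise is the contraction needed.
      by_cases hgS : g ∈ s'.S
      · have : Φ = 0 := by rw [hΦ, statePotential, if_pos hgS]
        simp [this]
      · have hlS := mass_normalize_lt_one hs'.w_pos hg hgS hs'.S_subset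
        have hl0 : ∀ h ∈ ch.pack, 0 ≤ l h := fun h hh =>
          capped_nonneg hlS (normalize_nonneg hs'.w_pos hh)
        have hl1 : mass l ch.pack = 1 :=
          mass_capped_univ (mass_normalize_self hs'.w_pos hg) hs'.S_subset hlS
        have hobj := le_objective_of_not_hasHeavyBall hP hl0 hl1 (c := c₄ / 20 * η)
          (by positivity) (by rw [radius]; nlinarith) (not_hasHeavyBall_expand hs hg hgS) hopt
        have := lintegral_update_le (κ := κ) hopt.2.1 (hPm g hg) (measurable_uncertainty hPm l)
          (uncertainty_nonneg hl0 hl1) (uncertainty_le_one hl0 hl1) herr hobj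
        calc _ ≤ ρ ^ n * Φ * ρ := by gcongr
          _ = ρ ^ (n + 1) * Φ := by ring
          _ ≤ _ := by gcongr
    have hgoal : (stage₁ ch (n + 1) s).bind f = Prog.query (ch.queryDist l)
        fun x y => (stage₁ ch n ⟨reweight ch.pack s'.w x y, s'.S, s'.C⟩).bind f := rfl
    rw [hgoal, show n + 1 + m = n + m + 1 by ring]
    refine hq.trans ?_
    gcongr

end StageOneThresholds

/-! ### The second stage -/

section StageTwo

variable {X : Type} [MeasurableSpace X] {D : Measure X} {Out : Type}

/-- An exponential moment bound for the number of errors that `countErrors` finds. -/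
theorem one_le_successProb_countErrors {κ : Kernel X Bool} [IsMarkovKernel κ] {q : Measure X}
    [IsProbabilityMeasure q] {h : Hyp X} (hh : Measurable h) {a b ρ : ℝ≥0∞}
    (hρ : ∫⁻ x, ∫⁻ y, (if h x ≠ y then a else b) ∂(κ x) ∂q ≤ ρ)
    {good : Set Out} (f : ℕ → Prog X Out) (t m : ℕ) (B : ℝ≥0∞)
    (hf : ∀ i j, i + j = t → 1 ≤ (f i).successProb κ good m + (a ^ i * b ^ j + B)) :
    ∀ n i j, i + j + n = t →
      1 ≤ ((countErrors q h n i).bind f).successProb κ good (n + m) +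
        (ρ ^ n * (a ^ i * b ^ j) + B)
  | 0, i, j, hij => by
    simp only [countErrors, Prog.bind, zero_add, pow_zero, one_mul]
    exact hf i j hij
  | n + 1, i, j, hij => by
    have ih := one_le_successProb_countErrors hh hρ f t m B hf n
    have hum : Measurable (Function.uncurry fun (x : X) (y : Bool) => if h x ≠ y then a else b) :=
      Measurable.ite (measurableSet_wrong hh) measurable_const measurable_const
    have hq := Prog.one_le_successProb_query (κ := κ) (good := good) q
      (fun x y => (countErrors q h n (if h x ≠ y then i + 1 else i)).bind f) (n + m)
      (fun x y => ρ ^ n * (a ^ i * b ^ j) * if h x ≠ y then a else b) (hum.const_mul _) B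
      fun x y => by
        by_cases hy : h x ≠ y
        · rw [if_pos hy, if_pos hy]
          refine (ih (i + 1) j (by omega)).trans_eq ?_
          ring
        · rw [if_neg hy, if_neg hy]
          refine (ih i (j + 1) (by omega)).trans_eq ?_
          ring
    have hgoal : (countErrors q h (n + 1) i).bind f = Prog.query q
        fun x y => (countErrors q h n (if h x ≠ y then i + 1 else i)).bind f := rfl
    rw [hgoal, show n + 1 + m = n + m + 1 by ring]
    refine hq.trans ?_
    gcongr
    have hm' : Measurable fun x => ∫⁻ y, (if h x ≠ y then a else b) ∂(κ x) :=
      hum.lintegral_kernel_prod_right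
    have e : ∀ x, ∫⁻ y, (ρ ^ n * (a ^ i * b ^ j) * if h x ≠ y then a else b) ∂(κ x) =
        ρ ^ n * (a ^ i * b ^ j) * ∫⁻ y, (if h x ≠ y then a else b) ∂(κ x) := fun x =>
      lintegral_const_mul _ (measurable_of_finite _)
    rw [lintegral_congr e, lintegral_const_mul _ hm']
    calc _ ≤ ρ ^ n * (a ^ i * b ^ j) * ρ := by gcongr
      _ = _ := by ring

/-- The expected multiplier, `3/2` for a wrong and `2/3` for a right label, of a hypothesis that is
wrong with probability at most `1/3`. -/
theorem lintegral_multiplier_le {κ : Kernel X Bool} [IsMarkovKernel κ] {q : Measure X}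
    [IsProbabilityMeasure q] {h : Hyp X}
    (hw : ∫⁻ x, κ x {y | h x ≠ y} ∂q ≤ ENNReal.ofReal (1 / 3)) :
    ∫⁻ x, ∫⁻ y, (if h x ≠ y then ENNReal.ofReal (3 / 2) else ENNReal.ofReal (2 / 3)) ∂(κ x) ∂q ≤
      ENNReal.ofReal (17 / 18) := by
  have inner : ∀ x, ∫⁻ y, (if h x ≠ y then ENNReal.ofReal (3 / 2) else ENNReal.ofReal (2 / 3))
      ∂(κ x) = ENNReal.ofReal (2 / 3) + ENNReal.ofReal (5 / 6) * κ x {y | h x ≠ y} := by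
    intro x
    have h1 : ∀ y, (if h x ≠ y then ENNReal.ofReal (3 / 2) else ENNReal.ofReal (2 / 3)) =
        ENNReal.ofReal (2 / 3) +
          Set.indicator {y | h x ≠ y} (fun _ => ENNReal.ofReal (5 / 6)) y := by
      intro y
      by_cases hy : h x ≠ y
      · rw [if_pos hy, Set.indicator_of_mem (show y ∈ {y | h x ≠ y} from hy),
          ← ENNReal.ofReal_add (by norm_num) (by norm_num)]
        norm_num
      · rw [if_neg hy, Set.indicator_of_notMem (show y ∉ {y | h x ≠ y} from hy), add_zero]
    rw [lintegral_congr h1, lintegral_add_left measurable_const,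
      lintegral_indicator_const MeasurableSet.of_discrete, lintegral_const, measure_univ, mul_one]
  rw [lintegral_congr inner, lintegral_add_left measurable_const,
    lintegral_const_mul' _ _ ENNReal.ofReal_ne_top, lintegral_const, measure_univ, mul_one]
  calc _ ≤ ENNReal.ofReal (2 / 3) + ENNReal.ofReal (5 / 6) * ENNReal.ofReal (1 / 3) := by gcongr
    _ = ENNReal.ofReal (17 / 18) := by
      rw [← ENNReal.ofReal_mul (by norm_num), ← ENNReal.ofReal_add (by norm_num) (by norm_num)]
      norm_num

/-- A hypothesis of error at most `ν` is wrong with probability at most `1/3` conditionally on an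
event of probability at least `3ν`. -/
theorem lintegral_wrong_cond_le [IsProbabilityMeasure D] {κ : Kernel X Bool} [IsMarkovKernel κ]
    {h : Hyp X} (hh : Measurable h) {A : Set X} {ν : ℝ} (hν : 0 < ν)
    (herr : err (D ⊗ₘ κ) h ≤ ν) (hA : 3 * ν ≤ D.real A) :
    ∫⁻ x, κ x {y | h x ≠ y} ∂(ProbabilityTheory.cond D A) ≤ ENNReal.ofReal (1 / 3) := by
  refine (lintegral_wrong_le (cond_le_smul A) hh).trans ?_
  have hpos : 0 < D.real A := by linarith
  rw [← ofReal_measureReal (μ := D) (s := A), ← ENNReal.ofReal_inv_of_pos hpos,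
    ← ENNReal.ofReal_mul (inv_nonneg.2 hpos.le)]
  refine ENNReal.ofReal_le_ofReal ?_
  rw [inv_mul_le_iff₀ hpos]
  linarith

variable {H : Set (Hyp X)} {c₄ c₅ η ε : ℝ}

/-- Each factor `a` cancels against a factor `b`, and the surplus factors are at least 1. This is
the Markov step: removing the protected hypothesis makes the exponential moment at least 1. -/
theorem one_le_ofReal_pow_mul_ofReal_pow {a b : ℝ} (ha : 0 < a) (hab : a * b = 1) {i j : ℕ}
    (hij : i ≤ j) (hb : 1 ≤ b) : 1 ≤ ENNReal.ofReal a ^ i * ENNReal.ofReal b ^ j := by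
  have hb0 : 0 ≤ b := by linarith
  rw [← ENNReal.ofReal_pow ha.le, ← ENNReal.ofReal_pow hb0, ← ENNReal.ofReal_mul (by positivity),
    ENNReal.one_le_ofReal]
  obtain ⟨k, rfl⟩ := Nat.exists_eq_add_of_le hij
  rw [pow_add, ← mul_assoc, ← mul_pow, hab, one_pow, one_mul]
  exact one_le_pow₀ hb

/-- Each comparison keeps a given hypothesis of small error, except with exponentially small
probability. -/
theorem one_le_successProb_comparison [IsProbabilityMeasure D] {κ : Kernel X Bool}
    [IsMarkovKernel κ] {h g h₀ : Hyp X} (hh : Measurable h) (hg : Measurable g) {ν : ℝ}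
    (hν : 0 < ν) (herr : err (D ⊗ₘ κ) h₀ ≤ ν) (hfar : 3 * ν ≤ hdist D h g) {good : Set Out}
    (t m : ℕ) (B : ℝ≥0∞) (f : Hyp X → Prog X Out)
    (hf : ∀ r, (r = h ∨ r = g) → r ≠ h₀ → 1 ≤ (f r).successProb κ good m + B) :
    1 ≤ ((countErrors (ProbabilityTheory.cond D {x | h x ≠ g x}) h t 0).bind
        fun e => f (if t ≤ 2 * e then h else g)).successProb κ good (t + m) +
      (ENNReal.ofReal (17 / 18) ^ t + B) := by
  set A := {x | h x ≠ g x} with hA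
  have hAm : MeasurableSet A := measurableSet_hyp_ne hh hg
  have hA0 : D A ≠ 0 := fun h0 => by
    rw [hdist, measureReal_def, h0] at hfar
    simp only [ENNReal.toReal_zero] at hfar
    linarith
  have hprob : IsProbabilityMeasure (ProbabilityTheory.cond D A) := cond_isProbabilityMeasure hA0
  have hne : h ≠ g := by
    rintro rfl
    rw [hdist_self] at hfar
    linarith
  -- The multipliers depend on which of the two is `h₀`: `3/2` goes with its errors and `2/3` with
  -- its correct labels, and both are zero if it takes no part.
  suffices hs : ∃ a b : ℝ≥0∞,
      (∫⁻ x, ∫⁻ y, (if h x ≠ y then a else b) ∂(κ x) ∂(ProbabilityTheory.cond D A) ≤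
        ENNReal.ofReal (17 / 18)) ∧
      ∀ i j, i + j = t → (if t ≤ 2 * i then h else g) = h₀ → 1 ≤ a ^ i * b ^ j by
    obtain ⟨a, b, hρ, hab⟩ := hs
    have := one_le_successProb_countErrors hh hρ (good := good)
      (fun e => f (if t ≤ 2 * e then h else g)) t m B (fun i j hij => by
        by_cases hr : (if t ≤ 2 * i then h else g) = h₀
        · exact (hab i j hij hr).trans (le_self_add.trans le_add_self)
        · refine (hf _ ?_ hr).trans ?_
          · split_ifs <;> simp
          · gcongr
            exact le_add_self) t 0 0 (by omega)
    simpa using this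
  by_cases h1 : h = h₀
  · refine ⟨ENNReal.ofReal (3 / 2), ENNReal.ofReal (2 / 3), ?_, ?_⟩
    · exact lintegral_multiplier_le (lintegral_wrong_cond_le hh hν (h1 ▸ herr) hfar)
    · intro i j hij hr
      have : t ≤ 2 * i := by
        by_contra hc
        rw [if_neg hc] at hr
        exact hne (h1.trans hr.symm)
      rw [mul_comm]
      exact one_le_ofReal_pow_mul_ofReal_pow (by norm_num) (by norm_num) (by omega) (by norm_num)
  by_cases h2 : g = h₀
  · refine ⟨ENNReal.ofReal (2 / 3), ENNReal.ofReal (3 / 2), ?_, ?_⟩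
    · refine le_trans (le_of_eq ?_)
        (lintegral_multiplier_le (lintegral_wrong_cond_le hg hν (h2 ▸ herr) hfar))
      -- On the conditioning event exactly one of `h`, `g` is right, so counting errors of `h`
      -- counts correct labels of `g`.
      refine lintegral_congr_ae ?_
      filter_upwards [ae_cond_mem hAm] with x hx
      refine lintegral_congr fun y => ?_
      have hx' : h x ≠ g x := hx
      by_cases hy : h x = y
      · rw [if_neg (not_not.2 hy), if_pos fun hc => hx' (hy.trans hc.symm)]
      · have : g x = y := by
          revert hx' hy
          cases h x <;> cases g x <;> cases y <;> simp
        rw [if_pos hy, if_neg (not_not.2 this)]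
    · intro i j hij hr
      have : ¬ t ≤ 2 * i := fun hc => by
        rw [if_pos hc] at hr
        exact h1 hr
      exact one_le_ofReal_pow_mul_ofReal_pow (by norm_num) (by norm_num) (by omega) (by norm_num)
  · refine ⟨0, 0, by simp, fun i j _ hr => ?_⟩
    split_ifs at hr
    · exact absurd hr h1
    · exact absurd hr h2

/-- The second stage returns a candidate close to a given candidate of small error. -/
theorem one_le_successProb_stage₂ [IsProbabilityMeasure D] {κ : Kernel X Bool}
    [IsMarkovKernel κ] (ch : Choices D H c₄ c₅ η ε) (hν : 0 < noise₂ c₄ c₅ η ε) {h₀ : Hyp X}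
    (herr : err (D ⊗ₘ κ) h₀ ≤ noise₂ c₄ c₅ η ε) {good : Set (Hyp X)} (t : ℕ) :
    ∀ (n : ℕ) (F : Finset (Hyp X)), h₀ ∈ F → (∀ h ∈ F, Measurable h) →
      (∀ h ∈ F, hdist D h h₀ < 3 * noise₂ c₄ c₅ η ε → h ∈ good) → F.card ≤ n →
      1 ≤ (stage₂ ch t n F).successProb κ good (n * t) +
        ((F.card - 1 : ℕ) : ℝ≥0∞) * ENNReal.ofReal (17 / 18) ^ t
  | 0, F, h₀F, _, _, hcard => absurd (Finset.card_pos.2 ⟨h₀, h₀F⟩) (by omega)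
  | n + 1, F, h₀F, hm, hgood, hcard => by
    rw [stage₂]
    by_cases hfar : ∃ h ∈ F, ∃ g ∈ F, 3 * noise₂ c₄ c₅ η ε ≤ hdist D h g
    · rw [if_pos hfar]
      obtain ⟨p1, p2, p3⟩ := ch.pair_spec F hfar
      have hne : (ch.pair F).1 ≠ (ch.pair F).2 := fun he => by
        rw [he, hdist_self] at p3
        linarith
      have hcard2 : 1 < F.card := Finset.one_lt_card.2 ⟨_, p1, _, p2, hne⟩
      have := one_le_successProb_comparison (good := good) (hm _ p1) (hm _ p2) hν herr p3 t (n * t)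
        (((F.card - 2 : ℕ) : ℝ≥0∞) * ENNReal.ofReal (17 / 18) ^ t)
        (fun r => stage₂ ch t n (F.erase r)) fun r hr hr0 => by
          have hrF : r ∈ F := by rcases hr with rfl | rfl <;> assumption
          have hc := Finset.card_erase_of_mem hrF
          have ih := one_le_successProb_stage₂ ch hν herr (good := good) t n (F.erase r)
            (Finset.mem_erase.2 ⟨hr0.symm, h₀F⟩) (fun h hh => hm h (Finset.mem_of_mem_erase hh))
            (fun h hh => hgood h (Finset.mem_of_mem_erase hh)) (by omega)
          rwa [hc, Nat.sub_sub] at ih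
      rw [show (n + 1) * t = t + n * t by ring]
      refine this.trans_eq ?_
      -- Truncated subtraction is harmless, since two distinct candidates are present. The extra 1
      -- is the failure of the current comparison in the union bound.
      rw [show F.card - 1 = F.card - 2 + 1 by omega]
      push_cast
      ring
    · rw [if_neg hfar]
      have hout := ch.out_spec F ⟨h₀, h₀F⟩
      have : ch.out F ∈ good := by
        refine hgood _ hout ?_
        push Not at hfar
        exact hfar _ hout _ h₀F
      simp [Prog.successProb, this]

end StageTwo

/-! ### Existence of the choices -/

theorem nonempty_choices {D : Measure ℝ} [IsProbabilityMeasure D] {T : Set ℝ} (hT : T.Nonempty)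
    {c₄ c₅ η ε : ℝ} (hc₄ : 0 ≤ c₄) (hη : 0 < η) :
    Nonempty (Choices D (thresholds T) c₄ c₅ η ε) := by
  obtain ⟨P, hP⟩ := exists_maximal_packing (D := D) (T := T) (show 0 < 2 * η by positivity)
  obtain ⟨τ, hτ⟩ := hT
  obtain ⟨g, hg, -⟩ := Maximal.exists_hdist_le (by positivity) hP
    (show (fun x : ℝ => decide (τ ≤ x)) ∈ thresholds T from ⟨τ, hτ, rfl⟩)
  have hcenter : ∀ l, ∃ μ, IsHeaviestCenter D P l (radius c₄ c₅ η ε) μ := fun l =>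
    let ⟨μ, hμ, hmax⟩ := P.exists_max_image
      (fun ν => mass l (ball D P ν (radius c₄ c₅ η ε))) ⟨g, hg⟩
    ⟨μ, hμ, hmax⟩
  have hquery : ∀ l, ∃ q, IsOptimalQuery D (uncertainty P l) (c₄ / 20 * η) q := fun l =>
    exists_isOptimalQuery (fun h hh => measurable_of_mem_thresholds (hP.1.1 h hh)) l (by positivity)
  have hpair : ∀ F : Finset (Hyp ℝ), ∃ p : Hyp ℝ × Hyp ℝ,
      (∃ h ∈ F, ∃ g ∈ F, 3 * noise₂ c₄ c₅ η ε ≤ hdist D h g) →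
        p.1 ∈ F ∧ p.2 ∈ F ∧ 3 * noise₂ c₄ c₅ η ε ≤ hdist D p.1 p.2 := by
    intro F
    by_cases hF : ∃ h ∈ F, ∃ g ∈ F, 3 * noise₂ c₄ c₅ η ε ≤ hdist D h g
    · obtain ⟨h, hh, f, hf, hd⟩ := hF
      exact ⟨(h, f), fun _ => ⟨hh, hf, hd⟩⟩
    · exact ⟨(g, g), fun h => absurd h hF⟩
  have hout : ∀ F : Finset (Hyp ℝ), ∃ o, F.Nonempty → o ∈ F := by
    intro F
    by_cases hF : F.Nonempty
    · exact ⟨hF.choose, fun _ => hF.choose_spec⟩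
    · exact ⟨g, fun h => absurd h hF⟩
  choose center center_spec using hcenter
  choose queryDist queryDist_spec using hquery
  choose pair pair_spec using hpair
  choose out out_spec using hout
  exact ⟨⟨P, hP, center, center_spec, queryDist, queryDist_spec, pair, pair_spec, out, out_spec⟩⟩

/-! ### Numerical bounds -/

section Numerics

/-- From `1 - 1/c ≤ exp (-1/c)`. The square leaves a factor `1/z` to spare after a union bound over,
or an initial potential of, the cardinality in `z`. -/
theorem pow_ceil_log_le {ρ c z : ℝ} (hρ : 0 ≤ ρ) (hc : 0 < c) (hρc : ρ ≤ 1 - 1 / c)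
    (hz : 0 < z) : ρ ^ ⌈2 * c * Real.log z⌉₊ ≤ (1 / z) ^ 2 := by
  have h1 : ρ ≤ Real.exp (-(1 / c)) := by
    have := Real.add_one_le_exp (-(1 / c))
    linarith
  have h2 : 2 * Real.log z ≤ ⌈2 * c * Real.log z⌉₊ * (1 / c) := by
    rw [mul_one_div, le_div_iff₀ hc]
    have := Nat.le_ceil (2 * c * Real.log z)
    linarith
  calc ρ ^ ⌈2 * c * Real.log z⌉₊ ≤ Real.exp (-(1 / c)) ^ ⌈2 * c * Real.log z⌉₊ :=
        pow_le_pow_left₀ hρ h1 _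
    _ = Real.exp (-(⌈2 * c * Real.log z⌉₊ * (1 / c))) := by
        rw [← Real.exp_nat_mul]; ring_nf
    _ ≤ Real.exp (-Real.log z + -Real.log z) := Real.exp_le_exp.2 (by linarith)
    _ = (1 / z) ^ 2 := by
        rw [Real.exp_add, Real.exp_neg, Real.exp_log hz, sq, one_div]

theorem one_le_lg (t : ℝ) : 1 ≤ lg t := le_max_left _ _

theorem log_le_lg (t : ℝ) : Real.log t ≤ lg t := le_max_right _ _

/-- With `l = lg (1/ε)` one has `l/δ = l + l (1/δ - 1) ≥ l + log (1/δ)`. Consequently the number of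
centers over `δ` is at most a constant times `(l/δ)^2`, whose logarithm is of the required order. -/
theorem lg_le_div {ε δ : ℝ} (hε : 0 < ε) (hδ : 0 < δ) (hδ1 : δ < 1) :
    lg (1 / (ε * δ)) ≤ lg (1 / ε) / δ := by
  have hl := one_le_lg (1 / ε)
  have h1 : 1 ≤ 1 / δ := (one_le_div hδ).2 hδ1.le
  have h2 : Real.log (1 / δ) ≤ 1 / δ - 1 := Real.log_le_sub_one_of_pos (by positivity)
  have h3 : lg (1 / ε) / δ = lg (1 / ε) * (1 / δ) := by ring
  rw [h3]
  refine max_le (by nlinarith) ?_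
  have h4 : 1 / (ε * δ) = 1 / ε * (1 / δ) := by field_simp
  rw [h4, Real.log_mul (by positivity) (by positivity)]
  have := log_le_lg (1 / ε)
  nlinarith

/-- The factor of the bound on the number of rounds of the first stage. -/
def roundsFactor (K₁ c₁ : ℝ) : ℝ := K₁ * (1 + Real.log c₁) + 1

/-- The factor of the bound on the number of queries per comparison. -/
def comparisonFactor (K₁ K₂ c₁ : ℝ) : ℝ := K₂ * (Real.log (roundsFactor K₁ c₁) + 2) + 1

theorem one_le_roundsFactor {K₁ c₁ : ℝ} (hK₁ : 0 < K₁) (hc₁ : 1 ≤ c₁) : 1 ≤ roundsFactor K₁ c₁ := by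
  have := Real.log_nonneg hc₁
  rw [roundsFactor]
  nlinarith

theorem one_le_comparisonFactor {K₁ K₂ c₁ : ℝ} (hK₁ : 0 < K₁) (hK₂ : 0 < K₂) (hc₁ : 1 ≤ c₁) :
    1 ≤ comparisonFactor K₁ K₂ c₁ := by
  have := Real.log_nonneg (one_le_roundsFactor hK₁ hc₁)
  rw [comparisonFactor]
  nlinarith

theorem rounds_le {K₁ c₁ N ε δ : ℝ} (hK₁ : 0 < K₁) (hc₁ : 1 ≤ c₁) (hε : 0 < ε) (hδ : 0 < δ)
    (hδ1 : δ < 1) (hN : 1 ≤ N) (hNε : N ≤ c₁ / ε) :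
    (⌈K₁ * Real.log (N / δ)⌉₊ : ℝ) ≤ roundsFactor K₁ c₁ * lg (1 / (ε * δ)) := by
  have h0 : 0 ≤ Real.log (N / δ) := Real.log_nonneg ((one_le_div hδ).2 (by linarith))
  have h1 := (Nat.ceil_lt_add_one (mul_nonneg hK₁.le h0)).le
  have h2 : Real.log (N / δ) ≤ Real.log c₁ + Real.log (1 / (ε * δ)) := by
    rw [← Real.log_mul (by positivity) (by positivity)]
    refine Real.log_le_log (by positivity) ?_
    calc N / δ ≤ c₁ / ε / δ := by gcongr
      _ = c₁ * (1 / (ε * δ)) := by field_simp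
  have h3 := log_le_lg (1 / (ε * δ))
  have h4 := one_le_lg (1 / (ε * δ))
  have h5 := Real.log_nonneg hc₁
  have h6 : Real.log (N / δ) ≤ (1 + Real.log c₁) * lg (1 / (ε * δ)) := by nlinarith
  have h7 := mul_le_mul_of_nonneg_left h6 hK₁.le
  rw [roundsFactor]
  nlinarith

theorem comparisons_le {K₁ K₂ c₁ ε δ n : ℝ} (hK₁ : 0 < K₁) (hK₂ : 0 < K₂) (hc₁ : 1 ≤ c₁)
    (hε : 0 < ε) (hδ : 0 < δ) (hδ1 : δ < 1) (hn : 1 ≤ n)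
    (hnle : n ≤ roundsFactor K₁ c₁ * lg (1 / (ε * δ))) :
    (⌈K₂ * Real.log (n / δ)⌉₊ : ℝ) ≤ comparisonFactor K₁ K₂ c₁ * lg (lg (1 / ε) / δ) := by
  set A := roundsFactor K₁ c₁ with hA
  have hA1 : 1 ≤ A := one_le_roundsFactor hK₁ hc₁
  set l := lg (1 / ε) with hl
  have hl1 : 1 ≤ l := one_le_lg _
  have h0 : 0 ≤ Real.log (n / δ) := Real.log_nonneg ((one_le_div hδ).2 (by linarith))
  have h1 := (Nat.ceil_lt_add_one (mul_nonneg hK₂.le h0)).le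
  have hld : 0 < l / δ := by positivity
  have h2 : n / δ ≤ A * (l / δ * (l / δ)) := by
    calc n / δ ≤ A * (l / δ) / δ := by
          gcongr
          exact hnle.trans (mul_le_mul_of_nonneg_left (lg_le_div hε hδ hδ1) (by linarith))
      _ = A * (l / δ * (1 / δ)) := by ring
      _ ≤ A * (l / δ * (l / δ)) := by gcongr
  have h3 : Real.log (n / δ) ≤ Real.log A + 2 * Real.log (l / δ) := by
    refine (Real.log_le_log (by positivity) h2).trans_eq ?_
    rw [Real.log_mul (by positivity) (by positivity), Real.log_mul hld.ne' hld.ne']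
    ring
  have h4 := log_le_lg (l / δ)
  have h5 := one_le_lg (l / δ)
  have h6 := Real.log_nonneg hA1
  have h7 : Real.log (n / δ) ≤ (Real.log A + 2) * lg (l / δ) := by nlinarith
  have h8 := mul_le_mul_of_nonneg_left h7 hK₂.le
  rw [comparisonFactor, ← hA]
  nlinarith

end Numerics

/-! ### The algorithm on thresholds -/

/-- With a small error of some hypothesis and a budget that allows for one comparison per
round, the algorithm fails with probability at most `δ`. -/
theorem ofReal_le_successProb_competitiveAlgorithm {D : Measure ℝ} [IsProbabilityMeasure D]
    {T : Set ℝ} {c₄ c₅ η η' ε δ : ℝ} (hη' : 0 < η') (hηη' : η ≤ η')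
    (hε : 0 < ε) (hδ : 0 < δ) (hδ1 : δ < 1) (hc₄ : 300 ≤ c₄) (hc₅ : 0 ≤ c₅)
    (hnoise : 4 * noise₂ c₄ c₅ η' ε ≤ η + ε) (ch : Choices D (thresholds T) c₄ c₅ η' ε)
    {κ : Kernel ℝ Bool} [IsMarkovKernel κ] (hopt : ∃ h ∈ thresholds T, err (D ⊗ₘ κ) h ≤ η)
    {n m : ℕ} (hn : n = ⌈240 * Real.log (ch.pack.card / δ)⌉₊)
    (hm : n + n * ⌈36 * Real.log (n / δ)⌉₊ ≤ m) :
    ENNReal.ofReal (1 - δ) ≤ (competitiveAlgorithm ch 240 36 δ).successProb κ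
      {h | h ∈ thresholds T ∧ err (D ⊗ₘ κ) h ≤ η + ε} m := by
  set P := ch.pack with hPdef
  have hP : ∀ h ∈ P, h ∈ thresholds T := ch.pack_spec.1.1
  have hPm : ∀ h ∈ P, Measurable h := fun h hh => measurable_of_mem_thresholds (hP h hh)
  have hfst : (D ⊗ₘ κ).fst = D := Measure.fst_compProd D κ
  have hR : 0 ≤ radius c₄ c₅ η' ε := by rw [radius]; positivity
  have hν : 0 < noise₂ c₄ c₅ η' ε := by rw [noise₂]; positivity
  obtain ⟨h, hh, herr⟩ := hopt
  obtain ⟨g, hg, hgh⟩ := Maximal.exists_hdist_le (by positivity) ch.pack_spec hh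
  have hgerr : err (D ⊗ₘ κ) g ≤ 3 * η' := by
    have := err_le_err_add_hdist hfst (hPm g hg) (measurable_of_mem_thresholds hh)
    linarith
  have hN1 : 1 ≤ P.card := Finset.card_pos.2 ⟨g, hg⟩
  have hN1' : (1 : ℝ) ≤ P.card := by exact_mod_cast hN1
  set good := {h | h ∈ thresholds T ∧ err (D ⊗ₘ κ) h ≤ η + ε} with hgood
  -- With one packing member there is one center and no comparison, so the first stage, whose
  -- failure bound is then `δ^2`, may use all of `δ`. With at least two members each stage fails
  -- with probability at most `δ/2`.
  set B : ℝ := if P.card = 1 then 0 else δ / 2 with hB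
  have hB0 : 0 ≤ B := by rw [hB]; split_ifs <;> positivity
  have stage_two : ∀ s : State ℝ, s.Valid ch → g ∈ s.S → s.C.card ≤ n →
      1 ≤ (stage₂ ch ⌈36 * Real.log (s.C.card / δ)⌉₊ s.C.card s.C).successProb κ good
        (n * ⌈36 * Real.log (n / δ)⌉₊) + ENNReal.ofReal B := by
    intro s hs hgs hcard
    obtain ⟨μ, hμ, hμg⟩ := hs.cover g hgs
    have hμerr : err (D ⊗ₘ κ) μ ≤ noise₂ c₄ c₅ η' ε := by
      have := err_le_err_add_hdist hfst (hPm μ (hs.C_subset hμ)) (hPm g hg)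
      rw [noise₂]
      linarith
    have hk1 : 1 ≤ s.C.card := Finset.card_pos.2 ⟨μ, hμ⟩
    have hk1' : (1 : ℝ) ≤ s.C.card := by exact_mod_cast hk1
    have hmain := one_le_successProb_stage₂ (κ := κ) ch hν hμerr (good := good)
      ⌈36 * Real.log (s.C.card / δ)⌉₊ s.C.card s.C hμ (fun f hf => hPm f (hs.C_subset hf))
      (fun f hf hd => by
        refine ⟨hP f (hs.C_subset hf), ?_⟩
        have := err_le_err_add_hdist hfst (hPm f (hs.C_subset hf)) (hPm μ (hs.C_subset hμ))
        linarith) le_rfl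
    refine hmain.trans (add_le_add (Prog.successProb_mono _ ?_) ?_)
    · have : (s.C.card : ℝ) ≤ n := by exact_mod_cast hcard
      exact Nat.mul_le_mul hcard (Nat.ceil_le_ceil (by gcongr))
    · by_cases h1 : s.C.card = 1
      · simp [h1]
      · have hk2 : (2 : ℝ) ≤ s.C.card := by
          have : 2 ≤ s.C.card := by omega
          exact_mod_cast this
        have hPne : P.card ≠ 1 := by
          have := Finset.card_le_card hs.C_subset
          rw [← hPdef] at this
          omega
        have hpow := pow_ceil_log_le (ρ := 17 / 18) (c := 18) (z := s.C.card / δ) (by norm_num)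
          (by norm_num) (by norm_num) (by positivity)
        rw [show (2 * 18 : ℝ) = 36 by norm_num] at hpow
        rw [hB, if_neg hPne, ← ENNReal.ofReal_natCast, ← ENNReal.ofReal_pow (by norm_num),
          ← ENNReal.ofReal_mul (by positivity)]
        refine ENNReal.ofReal_le_ofReal ?_
        rw [Nat.cast_sub hk1, Nat.cast_one]
        calc ((s.C.card : ℝ) - 1) * (17 / 18) ^ ⌈36 * Real.log (s.C.card / δ)⌉₊
            ≤ s.C.card * (1 / (s.C.card / δ)) ^ 2 := by
              refine mul_le_mul (by linarith) hpow (by positivity) (by positivity)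
          _ = δ * δ / s.C.card := by field_simp
          _ ≤ δ / 2 := by
              refine div_le_div₀ hδ.le (by nlinarith) (by norm_num) hk2
  have hvalid : State.Valid ch ⟨fun _ => 1, ∅, ∅⟩ :=
    ⟨fun _ _ => one_pos, by simp, by simp, by simp⟩
  -- Here `300 ≤ c₄` enters: `5 * err g ≤ 15 η' ≤ c₄ / 20 * η'`.
  have hfull := one_le_successProb_stage₁ (κ := κ) ch hη' hε.le (by linarith) hc₅ hg
    (by nlinarith) (good := good)
    (fun s => stage₂ ch ⌈36 * Real.log (s.C.card / δ)⌉₊ s.C.card s.C) n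
    (n * ⌈36 * Real.log (n / δ)⌉₊) (ENNReal.ofReal B) stage_two n ⟨fun _ => 1, ∅, ∅⟩ hvalid
    (by simp)
  have hsmall : ENNReal.ofReal (119 / 120) ^ n * statePotential P g ⟨fun _ => 1, ∅, ∅⟩ +
      ENNReal.ofReal B ≤ ENNReal.ofReal δ := by
    rw [statePotential, if_neg (by simp), potential_const, ← ENNReal.ofReal_pow (by norm_num),
      ← ENNReal.ofReal_mul (by positivity), ← ENNReal.ofReal_add (by positivity) hB0]
    refine ENNReal.ofReal_le_ofReal ?_
    have hpow := pow_ceil_log_le (ρ := 119 / 120) (c := 120) (z := P.card / δ) (by norm_num)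
      (by norm_num) (by norm_num) (by positivity)
    rw [show (2 * 120 : ℝ) = 240 by norm_num, ← hn] at hpow
    have h1 : (119 / 120 : ℝ) ^ n * P.card ≤ δ * δ / P.card := by
      refine (mul_le_mul_of_nonneg_right hpow (by positivity)).trans_eq ?_
      field_simp
    rw [hB]
    split_ifs with hc
    · rw [hc] at h1
      rw [hc]
      simp only [Nat.cast_one, div_one] at h1 ⊢
      nlinarith
    · have hk2 : (2 : ℝ) ≤ P.card := by
        have : 2 ≤ P.card := by omega
        exact_mod_cast this
      have h2 : δ * δ / P.card ≤ δ / 2 := div_le_div₀ hδ.le (by nlinarith) (by norm_num) hk2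
      linarith
  rw [ENNReal.ofReal_sub _ hδ.le, ENNReal.ofReal_one, tsub_le_iff_right]
  refine hfull.trans (add_le_add ?_ hsmall)
  rw [competitiveAlgorithm, ← hPdef, ← hn]
  exact Prog.successProb_mono _ hm

end

end ActiveLearning

open ActiveLearning

theorem corollary1 :
    ∃ c₁ c₄ c₅ K₁ K₂ K : ℝ,
      1 < c₁ ∧ 300 ≤ c₄ ∧ 0 < c₅ ∧ c₅ ≤ 1 / 10 ∧ 0 < K₁ ∧ 0 < K₂ ∧ 0 < K ∧
      ∀ (D : MeasureTheory.Measure ℝ), MeasureTheory.IsProbabilityMeasure D →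
      ∀ (T : Set ℝ), T.Nonempty →
      ∀ (η ε δ : ℝ), 0 ≤ η → 0 < ε → ε < 1 → 0 < δ → δ < 1 → c₁ * η < ε →
        Nonempty (ActiveLearning.Choices D (ActiveLearning.thresholds T) c₄ c₅ (ε / c₁) ε) ∧
        ∀ ch : ActiveLearning.Choices D (ActiveLearning.thresholds T) c₄ c₅ (ε / c₁) ε,
          ActiveLearning.Solves D (ActiveLearning.thresholds T) η ε δ
            ⌊K * ActiveLearning.lg (1 / (ε * δ)) *
              ActiveLearning.lg (ActiveLearning.lg (1 / ε) / δ)⌋₊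
            (ActiveLearning.competitiveAlgorithm ch K₁ K₂ δ) := by
  have hA := one_le_roundsFactor (K₁ := 240) (c₁ := 10000) (by norm_num) (by norm_num)
  have hB := one_le_comparisonFactor (K₁ := 240) (K₂ := 36) (c₁ := 10000) (by norm_num)
    (by norm_num) (by norm_num)
  -- Here `240 = 2 * 120` and `36 = 2 * 18` match the contraction factors `119/120` and `17/18`.
  -- With `η' = ε / 10000`, four times the second noise level is `3612 η' + 0.12 ε < ε`.
  refine ⟨10000, 300, 1 / 100, 240, 36,
    roundsFactor 240 10000 * (1 + comparisonFactor 240 36 10000), by norm_num, le_rfl,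
    by norm_num, by norm_num, by norm_num, by norm_num, by positivity, ?_⟩
  intro D hD T hT η ε δ hη hε hε1 hδ hδ1 hηε
  refine ⟨nonempty_choices hT (by norm_num) (by positivity), fun ch J κ hJ hκ hfst hJκ hopt => ?_⟩
  subst hJκ
  refine ofReal_le_successProb_competitiveAlgorithm (by positivity) ?_ hε hδ hδ1 le_rfl
    (by norm_num) ?_ ch hopt rfl ?_
  · rw [le_div_iff₀ (by norm_num)]
    linarith
  · rw [noise₂, radius]
    linarith
  have hNε : (ch.pack.card : ℝ) ≤ 10000 / ε := by
    refine (ch.pack_spec.1.card_le (by positivity)).trans ?_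
    rw [le_div_iff₀ hε, add_mul]
    have : 1 / (2 * (ε / 10000)) * ε = 5000 := by field_simp; norm_num
    linarith
  have hN1 : (1 : ℝ) ≤ ch.pack.card := by
    obtain ⟨h, hh, -⟩ := hopt
    obtain ⟨g, hg, -⟩ := Maximal.exists_hdist_le (by positivity) ch.pack_spec hh
    exact_mod_cast Finset.card_pos.2 ⟨g, hg⟩
  have hrounds := rounds_le (K₁ := 240) (by norm_num) (by norm_num) hε hδ hδ1 hN1 hNε
  set n := ⌈240 * Real.log (ch.pack.card / δ)⌉₊ with hn
  -- Strictness of `δ < 1` gives at least one round, even for a packing with one member.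
  have hn1 : (1 : ℝ) ≤ n := by
    have hlog : 0 < Real.log (ch.pack.card / δ) := Real.log_pos ((one_lt_div hδ).2 (by linarith))
    exact_mod_cast Nat.ceil_pos.2 (by positivity : 0 < 240 * Real.log (ch.pack.card / δ))
  have hcomp := comparisons_le (K₂ := 36) (by norm_num) (by norm_num) (by norm_num) hε hδ hδ1 hn1
    hrounds
  refine Nat.le_floor ?_
  push_cast
  have hL := one_le_lg (1 / (ε * δ))
  have hl := one_le_lg (lg (1 / ε) / δ)
  calc (n : ℝ) + n * ⌈36 * Real.log (n / δ)⌉₊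
      ≤ n + n * (comparisonFactor 240 36 10000 * lg (lg (1 / ε) / δ)) := by gcongr
    _ ≤ n * ((1 + comparisonFactor 240 36 10000) * lg (lg (1 / ε) / δ)) := by nlinarith
    _ ≤ roundsFactor 240 10000 * lg (1 / (ε * δ)) *
          ((1 + comparisonFactor 240 36 10000) * lg (lg (1 / ε) / δ)) := by gcongr
    _ = _ := by ring
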